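/- Let $n\ge 3$, let $\Omega\subset\mathbf{R}^n$ be open, and let $\varphi:\Omega\to\mathbf{R}$ be a function. Call $\varphi$ a *limiting Carleman weight* in $\Omega$ (for the Euclidean metric) if $\varphi$ is $C^\infty$, $d\varphi\neq 0$ at every point of $\Omega$, and $$\{\overline{p_\varphi},p_\varphi\}(x,\eta)=0\quad\text{for all }(x,\eta)\in\Omega\times\mathbf{R}^n\text{ with }p_\varphi(x,\eta)=0,$$ where $p_\varphi$ is the semiclassical principal symbol of the conjugated operator $e^{\varphi/h}(-h^2\Delta)e^{-\varphi/h}$, i.e. $p_\varphi(x,\eta)=|\eta|^2-|\nabla\varphi(x)|^2+2i\langle\eta,\nabla\varphi(x)\rangle$, and $\{f,g\}=\sum_j(\partial_{\eta_j}f\,\partial_{x_j}g-\partial_{x_j}f\,\partial_{\eta_j}g)$. Then $\varphi$ is a limiting Carleman weight in $\Omega$ if and only if every point of $\Omega$ has a neighbourhood in which $$\varphi(x)=a\,\varphi_0(x-x_0)+b$$ for some $a\in\mathbf{R}\setminus\{0\}$, $b\in\mathbf{R}$, $x_0\in\mathbf{R}^n$, where $\varphi_0$ is one of the following functions, and $x-x_0$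 stays in the set where the expression for $\varphi_0$ is defined: $$\langle x,\xi\rangle,\qquad \arg\langle x,\omega_1+i\omega_2\rangle,\qquad \log|x|,\qquad \frac{\langle x,\xi\rangle}{|x|^2},\qquad \arg\big(e^{i\theta}(x+i\xi)^2\big),\qquad \log\frac{|x+\xi|^2}{|x-\xi|^2},$$ with $\omega_1,\omega_2\in\mathbf{R}^n$ orthogonal unit vectors, $\theta\in[0,2\pi)$ and $\xi\in\mathbf{R}^n\setminus\{0\}$. Here $\langle x,\omega_1+i\omega_2\rangle=\langle x,\omega_1\rangle+i\langle x,\omega_2\rangle$, $(x+i\xi)^2=|x|^2-|\xi|^2+2i\langle x,\xi\rangle$, and $\arg z=2\arctan\frac{\operatorname{Im}z}{|z|+\operatorname{Re}z}$ for $z\in\mathbf{C}\setminus(-\infty,0]$. -/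

import Mathlib

open Filter Topology Set
open scoped ContDiff InnerProductSpace

noncomputable section

namespace LimitingCarleman

/-- The Euclidean space `ℝⁿ`. -/
abbrev E (n : ℕ) : Type := EuclideanSpace ℝ (Fin n)

variable {n : ℕ}

/-- The conjugated semiclassical Laplacian `P_{0,φ} u = e^{φ/h} (-h² Δ) (e^{-φ/h} u)` on complex-valued
functions on Euclidean space. -/
def conjugatedLaplacian (φ : E n → ℝ) (h : ℝ) (u : E n → ℂ) (x : E n) : ℂ :=
  Complex.exp (φ x / h) *
    (-(h : ℂ) ^ 2 * Laplacian.laplacian (fun y => Complex.exp (-(φ y / h)) * u y) x)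

/-- The plane wave `y ↦ e^{i⟨y, ξ⟩/h}`. -/
def planeWave (h : ℝ) (ξ : E n) (y : E n) : ℂ :=
  Complex.exp (Complex.I * (inner ℝ y ξ : ℝ) / h)

/-- The semiclassical principal symbol at `(x, ξ)` of a family `P h` (`h > 0`) of linear differential
operators, i.e. the leading term as `h → 0+` of the full symbol `e^{-i⟨x, ξ⟩/h} P_h e^{i⟨·, ξ⟩/h}`.
The full left symbol and the full Weyl symbol of a semiclassical differential operator differ by a
term of order `h`, so that this is also the principal symbol in Weyl quantization. -/
def principalSymbol (P : ℝ → (E n → ℂ) → E n → ℂ) (x ξ : E n) : ℂ :=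
  limUnder (𝓝[>] (0 : ℝ)) fun h => (planeWave h ξ x)⁻¹ * P h (planeWave h ξ) x

/-- The principal symbol `p_φ` of the conjugated Laplacian. -/
def carlemanSymbol (φ : E n → ℝ) : E n → E n → ℂ :=
  principalSymbol (conjugatedLaplacian φ)

lemma fderiv_fderiv_exp {w : E n → ℂ} {x : E n} (hw : ContDiffAt ℝ 2 w x) (v : E n) :
    fderiv ℝ (fderiv ℝ (fun y => Complex.exp (w y))) x v v =
      Complex.exp (w x) * (fderiv ℝ w x v ^ 2 + fderiv ℝ (fderiv ℝ w) x v v) := by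
  have h1 : fderiv ℝ (fun y => Complex.exp (w y)) =ᶠ[𝓝 x]
      fun y => Complex.exp (w y) • fderiv ℝ w y := by
    filter_upwards [hw.eventually (by simp)] with y hy
    exact (hy.differentiableAt (by norm_num)).hasFDerivAt.cexp.fderiv
  have hd : DifferentiableAt ℝ w x := hw.differentiableAt (by norm_num)
  have hd2 : DifferentiableAt ℝ (fderiv ℝ w) x :=
    (hw.fderiv_right (m := 1) (by norm_num)).differentiableAt (by norm_num)
  rw [h1.fderiv_eq, fderiv_fun_smul hd.cexp hd2, hd.hasFDerivAt.cexp.fderiv]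
  simp
  ring

/-- Where `φ` is `C²`, the full symbol converges as `h → 0+` and
`p_φ(x, ξ) = |ξ|² - |∇φ(x)|² + 2i⟨ξ, ∇φ(x)⟩`. -/
theorem carlemanSymbol_eq {φ : E n → ℝ} {x : E n} (hφ : ContDiffAt ℝ 2 φ x) (ξ : E n) :
    carlemanSymbol φ x ξ =
      ((‖ξ‖ ^ 2 - ‖gradient φ x‖ ^ 2 : ℝ) : ℂ) + 2 * Complex.I * (fderiv ℝ φ x ξ : ℝ) := by
  let ψ : E n → ℂ := fun y => Complex.I * (inner ℝ y ξ : ℝ) - (φ y : ℂ)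
  have hψ : ContDiffAt ℝ 2 ψ x := by
    have h1 : ContDiffAt ℝ 2 (fun y => (φ y : ℂ)) x := Complex.ofRealCLM.contDiff.contDiffAt.comp x hφ
    have h2 : ContDiffAt ℝ 2 (fun y : E n => ((inner ℝ y ξ : ℝ) : ℂ)) x :=
      Complex.ofRealCLM.contDiff.contDiffAt.comp x (contDiffAt_id.inner ℝ contDiffAt_const)
    exact (contDiffAt_const.mul h2).sub h1
  have hψ' (v : E n) : fderiv ℝ ψ x v = Complex.I * (inner ℝ v ξ : ℝ) - (fderiv ℝ φ x v : ℝ) := by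
    have h1 : HasFDerivAt (fun y => (φ y : ℂ)) (Complex.ofRealCLM.comp (fderiv ℝ φ x)) x :=
      Complex.ofRealCLM.hasFDerivAt.comp x (hφ.differentiableAt (by norm_num)).hasFDerivAt
    have h2 : HasFDerivAt (fun y : E n => ((inner ℝ y ξ : ℝ) : ℂ))
        (Complex.ofRealCLM.comp (innerSL ℝ ξ)) x := by
      have h3 := Complex.ofRealCLM.hasFDerivAt.comp x ((innerSL ℝ ξ).hasFDerivAt (x := x))
      have h4 : (fun y : E n => ((inner ℝ y ξ : ℝ) : ℂ)) = Complex.ofRealCLM ∘ (innerSL ℝ ξ) := by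
        funext y
        simp [real_inner_comm]
      rw [h4]
      exact h3
    have h5 : fderiv ℝ ψ x = _ := ((h2.const_mul Complex.I).sub h1).fderiv
    rw [h5]
    simp [real_inner_comm]
  set L : ℂ := ∑ j, fderiv ℝ (fderiv ℝ ψ) x (EuclideanSpace.single j 1) (EuclideanSpace.single j 1)
  set S : ℂ := ∑ j, fderiv ℝ ψ x (EuclideanSpace.single j 1) ^ 2 with hS
  have key (h : ℝ) (hh : 0 < h) : (planeWave h ξ x)⁻¹ * conjugatedLaplacian φ h (planeWave h ξ) x =
      -S - h * L := by
    have hh' : (h : ℂ) ≠ 0 := by exact_mod_cast hh.ne'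
    have e1 : (fun y => Complex.exp (-(φ y / h)) * planeWave h ξ y) =
        fun y => Complex.exp (((h : ℂ)⁻¹ • ψ) y) := by
      funext y
      simp only [planeWave, ← Complex.exp_add, ψ, Pi.smul_apply, smul_eq_mul]
      congr 1; field_simp; ring
    have hw : ContDiffAt ℝ 2 ((h : ℂ)⁻¹ • ψ) x := contDiffAt_const.smul hψ
    have f1 : fderiv ℝ ((h : ℂ)⁻¹ • ψ) =  (h : ℂ)⁻¹ • fderiv ℝ ψ := by
      exact fderiv_const_smul_field (𝕜 := ℝ) (R := ℂ) (f := ψ) ((h : ℂ)⁻¹)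
    rw [conjugatedLaplacian, e1, InnerProductSpace.laplacian_eq_iteratedFDeriv_orthonormalBasis _
      (EuclideanSpace.basisFun (Fin n) ℝ)]
    simp only [iteratedFDeriv_two_apply, Matrix.cons_val_zero, Matrix.cons_val_one,
      EuclideanSpace.basisFun_apply, fderiv_fderiv_exp hw]
    have f2 : fderiv ℝ ((h : ℂ)⁻¹ • fderiv ℝ ψ) x = (h : ℂ)⁻¹ • fderiv ℝ (fderiv ℝ ψ) x :=
      congrFun (fderiv_const_smul_field (𝕜 := ℝ) (R := ℂ) (f := fderiv ℝ ψ) ((h : ℂ)⁻¹)) x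
    rw [f1, f2]
    simp only [smul_apply, Pi.smul_apply, smul_eq_mul, ← Finset.mul_sum,
      Finset.sum_add_distrib, mul_pow]
    have e2 : (planeWave h ξ x)⁻¹ * (Complex.exp (φ x / h) * Complex.exp ((h : ℂ)⁻¹ * ψ x)) = 1 := by
      rw [planeWave, ← Complex.exp_neg, ← Complex.exp_add, ← Complex.exp_add, Complex.exp_eq_one_iff]
      exact ⟨0, by simp only [ψ]; field_simp; simp⟩
    change _ * (_ * (_ * (_ * (_ * S + _ * L)))) = _
    calc _ = ((planeWave h ξ x)⁻¹ * (Complex.exp (φ x / h) * Complex.exp ((h : ℂ)⁻¹ * ψ x))) *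
          (-(h : ℂ) ^ 2 * ((h : ℂ)⁻¹ ^ 2 * S + (h : ℂ)⁻¹ * L)) := by ring
      _ = _ := by rw [e2]; field_simp; ring
  have hlim : Tendsto (fun h : ℝ => (planeWave h ξ x)⁻¹ *
      conjugatedLaplacian φ h (planeWave h ξ) x) (𝓝[>] 0) (𝓝 (-S)) := by
    have : Tendsto (fun h : ℝ => -S - h * L) (𝓝[>] 0) (𝓝 (-S - (0 : ℝ) * L)) :=
      (Continuous.tendsto (by fun_prop) 0).mono_left nhdsWithin_le_nhds
    simp only [Complex.ofReal_zero, zero_mul, sub_zero] at this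
    refine this.congr' ?_
    filter_upwards [self_mem_nhdsWithin] with h hh
    exact (key h hh).symm
  have hgrad (v : E n) : fderiv ℝ φ x v = inner ℝ (gradient φ x) v := by
    simp [gradient]
  rw [carlemanSymbol, principalSymbol, hlim.limUnder_eq, hS, EuclideanSpace.real_norm_sq_eq, EuclideanSpace.real_norm_sq_eq,
    hgrad ξ, PiLp.inner_apply]
  simp only [hψ', hgrad, EuclideanSpace.inner_single_left, EuclideanSpace.inner_single_right]
  push_cast
  rw [Finset.mul_sum, ← Finset.sum_sub_distrib, ← Finset.sum_add_distrib, ← Finset.sum_neg_distrib]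
  refine Finset.sum_congr rfl fun j _ => ?_
  simp
  ring_nf
  simp

/-- The Poisson bracket `{f, g} = ∑ⱼ (∂f/∂ξⱼ ∂g/∂xⱼ - ∂f/∂xⱼ ∂g/∂ξⱼ)` of complex-valued functions of
`(x, ξ) ∈ T*ℝⁿ = ℝⁿ × ℝⁿ`. -/
def poissonBracket (f g : E n → E n → ℂ) (x ξ : E n) : ℂ :=
  ∑ j : Fin n,
    (fderiv ℝ (fun η => f x η) ξ (EuclideanSpace.single j 1) *
        fderiv ℝ (fun y => g y ξ) x (EuclideanSpace.single j 1) -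
      fderiv ℝ (fun y => f y ξ) x (EuclideanSpace.single j 1) *
        fderiv ℝ (fun η => g x η) ξ (EuclideanSpace.single j 1))

/-- `φ` is a limiting Carleman weight in `(Ω, e)`: it is smooth with non-vanishing differential in `Ω`
and, over `Ω`, the bracket of the complex conjugate of `p_φ` with `p_φ` vanishes wherever `p_φ` does. -/
structure IsLimitingCarlemanWeight (Ω : Set (E n)) (φ : E n → ℝ) : Prop where
  smooth : ContDiffOn ℝ ∞ φ Ω
  fderiv_ne_zero : ∀ x ∈ Ω, fderiv ℝ φ x ≠ 0
  bracket : ∀ x ∈ Ω, ∀ ξ : E n, carlemanSymbol φ x ξ = 0 →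
    poissonBracket (fun y η => (starRingEnd ℂ) (carlemanSymbol φ y η)) (carlemanSymbol φ) x ξ = 0

/-- The complex number `⟨x, ω₁ + i ω₂⟩ = ⟨x, ω₁⟩ + i ⟨x, ω₂⟩`. -/
def complexInner (ω₁ ω₂ x : E n) : ℂ :=
  (inner ℝ x ω₁ : ℝ) + Complex.I * (inner ℝ x ω₂ : ℝ)

/-- The complex number `(x + iξ)² = |x|² - |ξ|² + 2i⟨x, ξ⟩`, the complex-bilinear square. -/
def complexSquare (ξ x : E n) : ℂ :=
  ((‖x‖ ^ 2 - ‖ξ‖ ^ 2 : ℝ) : ℂ) + 2 * Complex.I * (inner ℝ x ξ : ℝ)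

/-- `IsModelWeight D φ₀`: `φ₀` is one of the six explicit weights, and `D` is the set where its
expression is defined. The argument is the principal one; its domain is the plane slit
along `(-∞, 0]`. -/
inductive IsModelWeight : Set (E n) → (E n → ℝ) → Prop
  | linear (ξ : E n) (hξ : ξ ≠ 0) :
      IsModelWeight univ (fun x => inner ℝ x ξ)
  | argLinear (ω₁ ω₂ : E n) (h₁ : ‖ω₁‖ = 1) (h₂ : ‖ω₂‖ = 1) (h₁₂ : inner ℝ ω₁ ω₂ = 0) :
      IsModelWeight {x | complexInner ω₁ ω₂ x ∈ Complex.slitPlane}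
        (fun x => (complexInner ω₁ ω₂ x).arg)
  | log :
      IsModelWeight {x | x ≠ 0} (fun x => Real.log ‖x‖)
  | inverted (ξ : E n) (hξ : ξ ≠ 0) :
      IsModelWeight {x | x ≠ 0} (fun x => inner ℝ x ξ / ‖x‖ ^ 2)
  | argSquare (θ : ℝ) (hθ : θ ∈ Ico 0 (2 * Real.pi)) (ξ : E n) (hξ : ξ ≠ 0) :
      IsModelWeight {x | Complex.exp (θ * Complex.I) * complexSquare ξ x ∈ Complex.slitPlane}
        (fun x => (Complex.exp (θ * Complex.I) * complexSquare ξ x).arg)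
  | logRatio (ξ : E n) (hξ : ξ ≠ 0) :
      IsModelWeight {x | x ≠ ξ ∧ x ≠ -ξ} (fun x => Real.log (‖x + ξ‖ ^ 2 / ‖x - ξ‖ ^ 2))

/-- Near `x`, the function `φ` equals `a φ₀(· - x₀) + b` with `a ≠ 0` and `φ₀` a model weight
that is defined there. -/
def IsLocallyModelAt (φ : E n → ℝ) (x : E n) : Prop :=
  ∃ (D : Set (E n)) (φ₀ : E n → ℝ), IsModelWeight D φ₀ ∧
    ∃ (a b : ℝ) (x₀ : E n), a ≠ 0 ∧ ∀ᶠ y in 𝓝 x, y - x₀ ∈ D ∧ φ y = a * φ₀ (y - x₀) + b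

end LimitingCarleman

end

namespace LimitingCarleman

/-! Put `X = ∇φ / |∇φ|²`. The bracket condition compares the Hessian on `∇φ` with the Hessian on its
orthogonal complement, and it makes the symmetric part of `DX` a scalar: `X` is conformal Killing
(`inner_fderiv_inverted_gradient`). For `n ≥ 3`, Liouville's theorem
(`IsConformalKilling.quadratic`) makes `X` locally a quadratic field `a + c y + B y + ⟨β, y⟩ y -
|y|² β / 2` with `B` skew.

Being parallel to a gradient, `X` also satisfies the Frobenius condition `X♭ ∧ dX♭ = 0`. This is
polynomial in `y`, so it propagates from a ball to the whole space and becomes algebra on `(a, c, B,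
β)`. The solutions (`isModelLike_of_integrable`) are, up to scaling and translation, constant,
radial or rotational fields when `β = 0`, and fields symmetric around the axis `β` otherwise, where
a sign separates three types. These are the fields of the six models. Since `X` determines `∇φ = X /
|X|²`, the weight is recovered up to an additive constant.

Conversely, every model has gradient `X / |X|²` with `X` conformal Killing, which gives back the
bracket condition (`carlemanCondition_of_conformalKilling`). -/

lemma two_le_infty : (2 : ℕ∞ω) ≤ ∞ := by
  exact WithTop.coe_le_coe.2 (le_top : (2 : ℕ∞) ≤ ⊤)

/-! ### The bracket condition as a condition on the Hessian. -/

section Bracket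

variable {n : ℕ} {φ : E n → ℝ} {x : E n}

lemma contDiffAt_gradient (hφ : ContDiffAt ℝ ∞ φ x) : ContDiffAt ℝ ∞ (gradient φ) x := by
  have h : ContDiffAt ℝ ∞ (fderiv ℝ φ) x := hφ.fderiv_right (by simp)
  have e : gradient φ = fun y => ∑ j : Fin n,
      fderiv ℝ φ y (EuclideanSpace.single j 1) • EuclideanSpace.single j (1 : ℝ) := by
    funext y
    rw [← (EuclideanSpace.basisFun (Fin n) ℝ).sum_repr (gradient φ y)]
    refine Finset.sum_congr rfl fun j _ => ?_
    rw [OrthonormalBasis.repr_apply_apply, real_inner_comm, inner_gradient_left]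
    simp
  rw [e]
  exact ContDiffAt.sum fun j _ => (h.clm_apply contDiffAt_const).smul contDiffAt_const

lemma inner_fderiv_gradient (hφ : ContDiffAt ℝ ∞ φ x) (u v : E n) :
    inner ℝ (fderiv ℝ (gradient φ) x u) v = fderiv ℝ (fderiv ℝ φ) x u v := by
  have h : DifferentiableAt ℝ (fderiv ℝ φ) x :=
    (hφ.fderiv_right (m := ∞) (by simp)).differentiableAt (by simp)
  have hg : DifferentiableAt ℝ (gradient φ) x := (contDiffAt_gradient hφ).differentiableAt (by simp)
  have e : (fun y => inner ℝ (gradient φ y) v) = fun y => fderiv ℝ φ y v := by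
    funext y; exact inner_gradient_left
  have h1 := congrArg (fun F => fderiv ℝ F x u) e
  rw [fderiv_inner_apply ℝ hg (differentiableAt_const v), fderiv_clm_apply h (differentiableAt_const v)] at h1
  simpa using h1

lemma inner_fderiv_gradient_comm (hφ : ContDiffAt ℝ ∞ φ x) (u v : E n) :
    inner ℝ (fderiv ℝ (gradient φ) x u) v = inner ℝ (fderiv ℝ (gradient φ) x v) u := by
  rw [inner_fderiv_gradient hφ, inner_fderiv_gradient hφ]
  exact hφ.isSymmSndFDerivAt (by simpa using two_le_infty) u v

/-- For `p = q + i r` the bracket is `2i {q, r}`; here `q = |η|² - |∇φ|²` and `r = 2⟨η, ∇φ⟩`. -/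
lemma poissonBracket_carlemanSymbol (hφ : ContDiffAt ℝ ∞ φ x) (ξ : E n) :
    poissonBracket (fun y η => (starRingEnd ℂ) (carlemanSymbol φ y η)) (carlemanSymbol φ) x ξ =
      8 * Complex.I * ((inner ℝ (fderiv ℝ (gradient φ) x ξ) ξ +
        inner ℝ (fderiv ℝ (gradient φ) x (gradient φ x)) (gradient φ x) : ℝ) : ℂ) := by
  have h2 : ContDiffAt ℝ 2 φ x := hφ.of_le two_le_infty
  set g := gradient φ with hg
  set H := fderiv ℝ g x with hH
  have hgd : HasFDerivAt g H x := ((contDiffAt_gradient hφ).differentiableAt (by simp)).hasFDerivAt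
  have hsymb (η : E n) : ∀ᶠ y in 𝓝 x, carlemanSymbol φ y η =
      ((‖η‖ ^ 2 - ‖g y‖ ^ 2 : ℝ) : ℂ) + 2 * Complex.I * (inner ℝ (g y) η : ℝ) := by
    filter_upwards [h2.eventually (by simp)] with y hy
    rw [carlemanSymbol_eq hy, inner_gradient_left]
  -- The parameter `s` treats the symbol (`s = 2i`) and its conjugate (`s = -2i`) together.
  have dη (s : ℂ) : HasFDerivAt (fun η : E n => ((‖η‖ ^ 2 - ‖g x‖ ^ 2 : ℝ) : ℂ) + s * (inner ℝ (g x) η : ℝ))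
      (Complex.ofRealCLM.comp (2 • innerSL ℝ ξ) + s • Complex.ofRealCLM.comp (innerSL ℝ (g x))) ξ := by
    have h1 : HasFDerivAt (fun η : E n => ‖η‖ ^ 2 - ‖g x‖ ^ 2) (2 • innerSL ℝ ξ) ξ := by
      simpa using (hasStrictFDerivAt_norm_sq ξ).hasFDerivAt.sub_const (‖g x‖ ^ 2)
    have h3 := Complex.ofRealCLM.hasFDerivAt.comp ξ h1
    have h4 := Complex.ofRealCLM.hasFDerivAt.comp ξ ((innerSL ℝ (g x)).hasFDerivAt (x := ξ))
    exact h3.add (h4.const_mul s)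
  have dx (s : ℂ) : HasFDerivAt (fun y : E n => ((‖ξ‖ ^ 2 - ‖g y‖ ^ 2 : ℝ) : ℂ) + s * (inner ℝ (g y) ξ : ℝ))
      (Complex.ofRealCLM.comp (-(2 • (innerSL ℝ (g x)).comp H)) +
        s • Complex.ofRealCLM.comp ((innerSL ℝ ξ).comp H)) x := by
    have h1 : HasFDerivAt (fun y : E n => ‖ξ‖ ^ 2 - ‖g y‖ ^ 2) (-(2 • (innerSL ℝ (g x)).comp H)) x := by
      simpa using hgd.norm_sq.const_sub (‖ξ‖ ^ 2)
    have h3 := Complex.ofRealCLM.hasFDerivAt.comp x h1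
    have h4 := Complex.ofRealCLM.hasFDerivAt.comp x (((innerSL ℝ ξ).hasFDerivAt (x := g x)).comp x hgd)
    have e : (fun y : E n => ((inner ℝ (g y) ξ : ℝ) : ℂ)) = fun y => ((innerSL ℝ ξ (g y) : ℝ) : ℂ) := by
      funext y; simp [real_inner_comm]
    have h5 := h4.const_mul s
    refine h3.add (HasFDerivAt.congr_of_eventuallyEq h5 (Eventually.of_forall fun y => ?_))
    simp [real_inner_comm]
  have conjsymb (y η : E n) : (starRingEnd ℂ) (((‖η‖ ^ 2 - ‖g y‖ ^ 2 : ℝ) : ℂ) + 2 * Complex.I * (inner ℝ (g y) η : ℝ))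
      = ((‖η‖ ^ 2 - ‖g y‖ ^ 2 : ℝ) : ℂ) + (-2 * Complex.I) * (inner ℝ (g y) η : ℝ) := by
    simp only [map_add, map_mul, Complex.conj_ofReal, Complex.conj_I, map_ofNat]; ring
  have hη : carlemanSymbol φ x = fun η => ((‖η‖ ^ 2 - ‖g x‖ ^ 2 : ℝ) : ℂ) + 2 * Complex.I * (inner ℝ (g x) η : ℝ) := by
    funext η; exact (hsymb η).self_of_nhds
  have e1 := (dη (2 * Complex.I)).fderiv
  rw [← hη] at e1
  have e2 := (dη (-2 * Complex.I)).fderiv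
  simp only [← conjsymb, ← congrFun hη] at e2
  have e3 := ((dx (2 * Complex.I)).congr_of_eventuallyEq (hsymb ξ)).fderiv
  have e4 := ((dx (-2 * Complex.I)).congr_of_eventuallyEq
    (f₁ := fun y => (starRingEnd ℂ) (carlemanSymbol φ y ξ)) (by
      filter_upwards [hsymb ξ] with y hy
      rw [hy, conjsymb])).fderiv
  have hsum (u : E n) : inner ℝ (H u) u = ∑ j : Fin n,
      inner ℝ u (EuclideanSpace.single j 1) * inner ℝ u (H (EuclideanSpace.single j 1)) := by
    rw [← (EuclideanSpace.basisFun (Fin n) ℝ).sum_inner_mul_inner (H u) u]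
    refine Finset.sum_congr rfl fun j _ => ?_
    rw [EuclideanSpace.basisFun_apply, hH, hg, inner_fderiv_gradient_comm hφ, real_inner_comm u,
      real_inner_comm u, mul_comm]
  rw [poissonBracket, hsum, hsum, ← Finset.sum_add_distrib]
  push_cast
  rw [Finset.mul_sum]
  refine Finset.sum_congr rfl fun j _ => ?_
  rw [e1, e2, e3, e4]
  simp only [add_apply, smul_apply, neg_apply,
    ContinuousLinearMap.comp_apply, innerSL_apply_apply, Complex.ofRealCLM_apply, smul_eq_mul, nsmul_eq_mul]
  push_cast
  ring_nf

lemma carlemanCondition_iff (hφ : ContDiffAt ℝ ∞ φ x) :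
    (∀ ξ : E n, carlemanSymbol φ x ξ = 0 →
      poissonBracket (fun y η => (starRingEnd ℂ) (carlemanSymbol φ y η)) (carlemanSymbol φ) x ξ = 0) ↔
    ∀ ξ : E n, ‖ξ‖ = ‖gradient φ x‖ → inner ℝ (gradient φ x) ξ = 0 →
      inner ℝ (fderiv ℝ (gradient φ) x ξ) ξ +
        inner ℝ (fderiv ℝ (gradient φ) x (gradient φ x)) (gradient φ x) = 0 := by
  refine forall_congr' fun ξ => ?_
  rw [poissonBracket_carlemanSymbol hφ, carlemanSymbol_eq (hφ.of_le two_le_infty),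
    ← inner_gradient_left (𝕜 := ℝ), ← and_imp]
  refine imp_congr ?_ ?_
  · rw [Complex.ext_iff]
    simp only [Complex.add_re, Complex.ofReal_re, Complex.mul_re, Complex.re_ofNat, Complex.I_re,
      Complex.im_ofNat, Complex.I_im, Complex.ofReal_im, Complex.add_im, Complex.mul_im]
    constructor
    · rintro ⟨h1, h2⟩
      rw [inner_gradient_left]
      simp only [inner_gradient_left] at h1 h2
      simp at h1 h2
      exact ⟨(sq_eq_sq₀ (norm_nonneg _) (norm_nonneg _)).1 (by linarith), h2⟩
    · rintro ⟨h1, h2⟩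
      simp [h1, h2]
  · simp [Complex.ext_iff]

end Bracket

/-! ### Liouville's theorem for conformal Killing fields. -/

section ConformalKilling

variable {V : Type*} [NormedAddCommGroup V] [InnerProductSpace ℝ V]

/-- This is how the dimension hypothesis is used: there is always a direction to spare beside two
given vectors. -/
lemma exists_unit_orthogonal (hV : 3 ≤ Module.finrank ℝ V) (u v : V) :
    ∃ e : V, ‖e‖ = 1 ∧ inner ℝ u e = 0 ∧ inner ℝ v e = 0 := by
  have : FiniteDimensional ℝ V := Module.finite_of_finrank_pos (by omega)
  classical
  set W := Submodule.span ℝ ({u, v} : Set V) with hW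
  have h1 : Module.finrank ℝ W ≤ 2 := by
    have := finrank_span_finset_le_card (R := ℝ) ({u, v} : Finset V)
    simp only [Finset.coe_insert, Finset.coe_singleton] at this
    exact this.trans Finset.card_le_two
  have h2 := W.finrank_add_finrank_orthogonal
  have h3 : Wᗮ ≠ ⊥ := by
    intro h
    rw [h, finrank_bot] at h2
    omega
  obtain ⟨e, he, he0⟩ := Submodule.exists_mem_ne_zero_of_ne_bot h3
  rw [Submodule.mem_orthogonal] at he
  refine ⟨‖e‖⁻¹ • e, norm_smul_inv_norm (𝕜 := ℝ) he0, ?_, ?_⟩ <;> rw [inner_smul_right, he, mul_zero] <;>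
    exact Submodule.subset_span (by simp)

/-- The directional derivative of a scalar function. -/
noncomputable def dirDeriv (u : V) (F : V → ℝ) (x : V) : ℝ := fderiv ℝ F x u

variable {U : Set V} {F G : V → ℝ} {x : V}

lemma contDiffOn_dirDeriv (hU : IsOpen U) (hF : ContDiffOn ℝ ∞ F U) (u : V) :
    ContDiffOn ℝ ∞ (dirDeriv u F) U :=
  (hF.fderiv_of_isOpen hU (by simp)).clm_apply contDiffOn_const

lemma dirDeriv_congr (hU : IsOpen U) (h : ∀ y ∈ U, F y = G y) (hx : x ∈ U) (u : V) :
    dirDeriv u F x = dirDeriv u G x := by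
  rw [dirDeriv, dirDeriv, (eventuallyEq_of_mem (hU.mem_nhds hx) h).fderiv_eq]

lemma differentiableAt_of_smoothOn {W : Type*} [NormedAddCommGroup W] [NormedSpace ℝ W] {F : V → W}
    (hU : IsOpen U) (hF : ContDiffOn ℝ ∞ F U) (hx : x ∈ U) : DifferentiableAt ℝ F x :=
  (hF.contDiffAt (hU.mem_nhds hx)).differentiableAt (by simp)

lemma dirDeriv_add (hU : IsOpen U) (hF : ContDiffOn ℝ ∞ F U) (hG : ContDiffOn ℝ ∞ G U) (hx : x ∈ U)
    (u : V) : dirDeriv u (fun y => F y + G y) x = dirDeriv u F x + dirDeriv u G x := by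
  simp [dirDeriv, fderiv_fun_add (differentiableAt_of_smoothOn hU hF hx)
    (differentiableAt_of_smoothOn hU hG hx)]

lemma dirDeriv_const_mul (hU : IsOpen U) (hF : ContDiffOn ℝ ∞ F U) (hx : x ∈ U) (c : ℝ) (u : V) :
    dirDeriv u (fun y => c * F y) x = c * dirDeriv u F x := by
  simp [dirDeriv, fderiv_const_mul (differentiableAt_of_smoothOn hU hF hx)]

lemma dirDeriv_dirDeriv (hU : IsOpen U) (hF : ContDiffOn ℝ ∞ F U) (hx : x ∈ U) (u v : V) :
    dirDeriv u (dirDeriv v F) x = fderiv ℝ (fderiv ℝ F) x u v := by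
  have h := differentiableAt_of_smoothOn hU (hF.fderiv_of_isOpen (m := ∞) hU (by simp)) hx
  change fderiv ℝ (fun y => fderiv ℝ F y v) x u = _
  rw [fderiv_clm_apply h (differentiableAt_const v)]
  simp

lemma dirDeriv_comm (hU : IsOpen U) (hF : ContDiffOn ℝ ∞ F U) (hx : x ∈ U) (u v : V) :
    dirDeriv u (dirDeriv v F) x = dirDeriv v (dirDeriv u F) x := by
  rw [dirDeriv_dirDeriv hU hF hx, dirDeriv_dirDeriv hU hF hx]
  refine (hF.contDiffAt (hU.mem_nhds hx)).isSymmSndFDerivAt ?_ u v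
  rw [minSmoothness_of_isRCLikeNormedField]
  exact two_le_infty

variable {X : V → V} {f : V → ℝ}

/-- A conformal Killing field: the symmetric part of the derivative is a scalar. -/
def IsConformalKilling (U : Set V) (X : V → V) (f : V → ℝ) : Prop :=
  ∀ x ∈ U, ∀ z, inner ℝ (fderiv ℝ X x z) z = f x * ‖z‖ ^ 2

lemma IsConformalKilling.polarized (hK : IsConformalKilling U X f) (hx : x ∈ U) (y z : V) :
    inner ℝ (fderiv ℝ X x y) z + inner ℝ (fderiv ℝ X x z) y = 2 * inner ℝ y z * f x := by
  have h1 := hK x hx (y + z)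
  have h2 := hK x hx y
  have h3 := hK x hx z
  rw [map_add, inner_add_left, inner_add_right, inner_add_right, norm_add_sq_real] at h1
  linarith

lemma IsConformalKilling.smooth_factor (hU : IsOpen U) (hX : ContDiffOn ℝ ∞ X U)
    (hK : IsConformalKilling U X f) (hV : 3 ≤ Module.finrank ℝ V) : ContDiffOn ℝ ∞ f U := by
  obtain ⟨e, he, -⟩ := exists_unit_orthogonal hV 0 0
  have h : ContDiffOn ℝ ∞ (fun x => inner ℝ (fderiv ℝ X x e) e) U :=
    ((hX.fderiv_of_isOpen hU (by simp)).clm_apply contDiffOn_const).inner ℝ contDiffOn_const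
  refine h.congr fun x hx => ?_
  rw [hK x hx, he]; simp

lemma dirDeriv_inner (hU : IsOpen U) (hX : ContDiffOn ℝ ∞ X U) (hx : x ∈ U) (y z : V) :
    dirDeriv y (fun x => inner ℝ (X x) z) x = inner ℝ (fderiv ℝ X x y) z := by
  rw [dirDeriv, fderiv_inner_apply ℝ (differentiableAt_of_smoothOn hU hX hx) (differentiableAt_const z)]
  simp

lemma dirDeriv_dirDeriv_inner (hU : IsOpen U) (hX : ContDiffOn ℝ ∞ X U) (hx : x ∈ U) (u y z : V) :
    dirDeriv u (dirDeriv y fun x => inner ℝ (X x) z) x = inner ℝ (fderiv ℝ (fderiv ℝ X) x u y) z := by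
  have hX' := hX.fderiv_of_isOpen (m := ∞) hU (by simp)
  have h := dirDeriv_inner hU (hX'.clm_apply (contDiffOn_const (c := y))) hx u z
  rw [fderiv_clm_apply (differentiableAt_of_smoothOn hU hX' hx) (differentiableAt_const y)] at h
  rw [dirDeriv_congr hU (fun w hw => dirDeriv_inner hU hX hw y z) hx]
  simpa using h

/-- The algebra of the Koszul formula: the differentiated Killing equation controls the part
symmetric in `y, z`, second derivatives commute in `u, y`, and three cyclic permutations isolate a
single term. -/
lemma IsConformalKilling.second_derivative (hU : IsOpen U) (hX : ContDiffOn ℝ ∞ X U)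
    (hK : IsConformalKilling U X f) (hV : 3 ≤ Module.finrank ℝ V) (hx : x ∈ U) (u y z : V) :
    dirDeriv u (dirDeriv y fun x => inner ℝ (X x) z) x =
      inner ℝ y z * dirDeriv u f x + inner ℝ u z * dirDeriv y f x - inner ℝ u y * dirDeriv z f x := by
  have hf := hK.smooth_factor hU hX hV
  have hc (z : V) : ContDiffOn ℝ ∞ (fun x => inner ℝ (X x) z) U := hX.inner ℝ contDiffOn_const
  have sym (u y z : V) := dirDeriv_comm hU (hc z) hx u y
  have rel (u y z : V) : dirDeriv u (dirDeriv y fun x => inner ℝ (X x) z) x +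
      dirDeriv u (dirDeriv z fun x => inner ℝ (X x) y) x = 2 * inner ℝ y z * dirDeriv u f x := by
    rw [← dirDeriv_add hU (contDiffOn_dirDeriv hU (hc z) y) (contDiffOn_dirDeriv hU (hc y) z) hx,
      ← dirDeriv_const_mul hU hf hx]
    refine dirDeriv_congr hU (fun w hw => ?_) hx u
    rw [dirDeriv_inner hU hX hw, dirDeriv_inner hU hX hw, hK.polarized hw]
  have h1 := rel u y z
  have h2 := rel z u y
  have h3 := rel y z u
  rw [sym z u y] at h2
  rw [sym y z u, sym y u z, real_inner_comm u z] at h3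
  linarith

/-- Differentiate the formula for the second derivatives of `X` along `w`; third derivatives are
symmetric in `w` and `u`. -/
lemma IsConformalKilling.hessian_relation (hU : IsOpen U) (hX : ContDiffOn ℝ ∞ X U)
    (hK : IsConformalKilling U X f) (hV : 3 ≤ Module.finrank ℝ V) (hx : x ∈ U) (w u y z : V) :
    inner ℝ u z * dirDeriv w (dirDeriv y f) x - inner ℝ u y * dirDeriv w (dirDeriv z f) x =
      inner ℝ w z * dirDeriv u (dirDeriv y f) x - inner ℝ w y * dirDeriv u (dirDeriv z f) x := by
  have hf := hK.smooth_factor hU hX hV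
  have hc : ContDiffOn ℝ ∞ (fun x => inner ℝ (X x) z) U := hX.inner ℝ contDiffOn_const
  have hd (v : V) := contDiffOn_dirDeriv hU hf v
  have key (w u : V) : dirDeriv w (dirDeriv u (dirDeriv y fun x => inner ℝ (X x) z)) x =
      inner ℝ y z * dirDeriv w (dirDeriv u f) x + inner ℝ u z * dirDeriv w (dirDeriv y f) x -
        inner ℝ u y * dirDeriv w (dirDeriv z f) x := by
    rw [dirDeriv_congr hU (G := fun x => (inner ℝ y z * dirDeriv u f x + inner ℝ u z * dirDeriv y f x) +
        (-inner ℝ u y) * dirDeriv z f x)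
      (fun v hv => by rw [hK.second_derivative hU hX hV hv]; ring) hx,
      dirDeriv_add hU ((contDiffOn_const.mul (hd u)).add (contDiffOn_const.mul (hd y)))
        (contDiffOn_const.mul (hd z)) hx,
      dirDeriv_add hU (contDiffOn_const.mul (hd u)) (contDiffOn_const.mul (hd y)) hx,
      dirDeriv_const_mul hU (hd u) hx, dirDeriv_const_mul hU (hd y) hx, dirDeriv_const_mul hU (hd z) hx]
    ring
  have h1 := dirDeriv_comm hU (contDiffOn_dirDeriv hU hc y) hx w u
  rw [key, key, dirDeriv_comm hU hf hx w u] at h1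
  linarith

/-- For a unit vector `e ⊥ w`, the relation gives `Hess f(w, w) = -|w|² Hess f(e, e)`. Two
orthonormal vectors `e, d ⊥ w` also satisfy `Hess f(e, e) = -Hess f(d, d)`, and the signs are
incompatible unless everything vanishes. Polarization finishes. -/
lemma IsConformalKilling.hessian_eq_zero (hU : IsOpen U) (hX : ContDiffOn ℝ ∞ X U)
    (hK : IsConformalKilling U X f) (hV : 3 ≤ Module.finrank ℝ V) (hx : x ∈ U) (u v : V) :
    fderiv ℝ (fderiv ℝ f) x u v = 0 := by
  have hf := hK.smooth_factor hU hX hV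
  have neg {e w : V} (he : ‖e‖ = 1) (hew : inner ℝ w e = 0) :
      fderiv ℝ (fderiv ℝ f) x w w = -‖w‖ ^ 2 * fderiv ℝ (fderiv ℝ f) x e e := by
    have h := hK.hessian_relation hU hX hV hx w e w e
    simp only [real_inner_comm w e, hew, real_inner_self_eq_norm_sq, he, dirDeriv_dirDeriv hU hf hx] at h
    linarith
  have quad (w : V) : fderiv ℝ (fderiv ℝ f) x w w = 0 := by
    obtain ⟨e, he, hwe, -⟩ := exists_unit_orthogonal hV w w
    obtain ⟨d, hd, hwd, hed⟩ := exists_unit_orthogonal hV w e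
    have h1 := neg he hwe
    have h2 := neg hd hwd
    have h3 := neg hd hed
    rw [he] at h3
    nlinarith
  have h := quad (u + v)
  have hs : fderiv ℝ (fderiv ℝ f) x u v = fderiv ℝ (fderiv ℝ f) x v u := by
    rw [← dirDeriv_dirDeriv hU hf hx, dirDeriv_comm hU hf hx,
      dirDeriv_dirDeriv hU hf hx]
  simp only [map_add, add_apply, quad] at h
  linarith

lemma quadratic_of_second_fderiv_const {W : Type*} [NormedAddCommGroup W] [NormedSpace ℝ W] {F : V → W}
    {p : V} {r : ℝ} (hr : 0 < r) (hF : ContDiffOn ℝ ∞ F (Metric.ball p r))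
    (h : ∀ x ∈ Metric.ball p r, fderiv ℝ (fderiv ℝ F) x = fderiv ℝ (fderiv ℝ F) p)
    (hx : x ∈ Metric.ball p r) :
    fderiv ℝ F x = fderiv ℝ F p + fderiv ℝ (fderiv ℝ F) p (x - p) ∧
      F x = F p + fderiv ℝ F p (x - p) + (1 / 2 : ℝ) • fderiv ℝ (fderiv ℝ F) p (x - p) (x - p) := by
  set S := fderiv ℝ (fderiv ℝ F) p with hS
  have hp : p ∈ Metric.ball p r := Metric.mem_ball_self hr
  have hU : IsOpen (Metric.ball p r) := Metric.isOpen_ball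
  have hU' : IsPreconnected (Metric.ball p r) := (convex_ball p r).isPreconnected
  have hF' := hF.fderiv_of_isOpen (m := ∞) hU (by simp)
  have sym (u v : V) : S u v = S v u := by
    refine (hF.contDiffAt (hU.mem_nhds hp)).isSymmSndFDerivAt ?_ u v
    rw [minSmoothness_of_isRCLikeNormedField]
    exact two_le_infty
  have e0 (x : V) : HasFDerivAt (fun y => y - p) (ContinuousLinearMap.id ℝ V) x :=
    (hasFDerivAt_id x).sub_const p
  have e1 (x : V) : HasFDerivAt (fun y => fderiv ℝ F p + S (y - p)) S x := by
    simpa using ((S.hasFDerivAt.comp x (e0 x)).const_add (fderiv ℝ F p))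
  have h1 : EqOn (fderiv ℝ F) (fun y => fderiv ℝ F p + S (y - p)) (Metric.ball p r) :=
    hU.eqOn_of_fderiv_eq hU' (fun y hy => (differentiableAt_of_smoothOn hU hF' hy).differentiableWithinAt)
      (fun y _ => (e1 y).differentiableAt.differentiableWithinAt)
      (fun y hy => by rw [h y hy, (e1 y).fderiv]) hp (by simp)
  have e2 (x : V) : HasFDerivAt
      (fun y => F p + fderiv ℝ F p (y - p) + (1 / 2 : ℝ) • S (y - p) (y - p))
      (fderiv ℝ F p + S (x - p)) x := by
    have a1 := ((fderiv ℝ F p).hasFDerivAt.comp x (e0 x)).const_add (F p)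
    have a2 := ((S.hasFDerivAt.comp x (e0 x)).clm_apply (e0 x)).const_smul (1 / 2 : ℝ)
    refine (a1.add a2).congr_fderiv ?_
    ext v
    simp only [map_sub]
    simp [sym v x, sym v p]
    module
  have h2 : EqOn F (fun y => F p + fderiv ℝ F p (y - p) + (1 / 2 : ℝ) • S (y - p) (y - p))
      (Metric.ball p r) :=
    hU.eqOn_of_fderiv_eq hU' (fun y hy => (differentiableAt_of_smoothOn hU hF hy).differentiableWithinAt)
      (fun y _ => (e2 y).differentiableAt.differentiableWithinAt)
      (fun y hy => by rw [(e2 y).fderiv]; exact h1 hy) hp (by simp)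
  exact ⟨h1 hx, h2 hx⟩

/-- **Liouville's theorem** for conformal Killing fields in dimension at least three. -/
theorem IsConformalKilling.quadratic {p : V} {r : ℝ} (hr : 0 < r) (hX : ContDiffOn ℝ ∞ X (Metric.ball p r))
    (hK : IsConformalKilling (Metric.ball p r) X f) (hV : 3 ≤ Module.finrank ℝ V) :
    ∃ (β : V) (B : V →L[ℝ] V), (∀ y, inner ℝ (B y) y = 0) ∧ ∀ x ∈ Metric.ball p r,
      (∀ y, fderiv ℝ X x y = f p • y + B y + inner ℝ β (x - p) • y + inner ℝ β y • (x - p) -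
        inner ℝ (x - p) y • β) ∧
      X x = X p + f p • (x - p) + B (x - p) + inner ℝ β (x - p) • (x - p) -
        (‖x - p‖ ^ 2 / 2) • β := by
  have hV' : FiniteDimensional ℝ V := Module.finite_of_finrank_pos (by omega)
  have hU : IsOpen (Metric.ball p r) := Metric.isOpen_ball
  have hp : p ∈ Metric.ball p r := Metric.mem_ball_self hr
  have hf := hK.smooth_factor hU hX hV
  have hf' : ∀ x ∈ Metric.ball p r, fderiv ℝ f x = fderiv ℝ f p := fun x hx =>
    hU.is_const_of_fderiv_eq_zero (convex_ball p r).isPreconnected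
      (fun y hy => (differentiableAt_of_smoothOn hU (hf.fderiv_of_isOpen (m := ∞) hU (by simp))
        hy).differentiableWithinAt)
      (fun y hy => by ext u v; exact hK.hessian_eq_zero hU hX hV hy u v) hx hp
  set β := gradient f p with hβ
  have hβ' (v : V) : fderiv ℝ f p v = inner ℝ β v := inner_gradient_left.symm
  have hS : ∀ x ∈ Metric.ball p r, ∀ u y, fderiv ℝ (fderiv ℝ X) x u y =
      inner ℝ β u • y + inner ℝ β y • u - inner ℝ u y • β := by
    intro x hx u y
    refine ext_inner_right ℝ fun z => ?_
    rw [← dirDeriv_dirDeriv_inner hU hX hx, hK.second_derivative hU hX hV hx]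
    simp only [dirDeriv, hf' x hx, hβ', inner_sub_left, inner_add_left, inner_smul_left]
    simp
    ring
  have hq := fun x hx => quadratic_of_second_fderiv_const (x := x) hr hX
    (fun x hx => by ext u y; rw [hS x hx, hS p hp]) hx
  -- Removing the scalar part of `DX` at `p` leaves its skew part.
  refine ⟨β, fderiv ℝ X p - f p • ContinuousLinearMap.id ℝ V, fun y => ?_, fun x hx => ⟨fun y => ?_, ?_⟩⟩
  · simp [inner_sub_left, inner_smul_left, hK p hp]
  · rw [(hq x hx).1, add_apply, hS p hp]
    simp; abel
  · conv_lhs => rw [(hq x hx).2, hS p hp]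
    simp only [real_inner_self_eq_norm_sq, sub_apply, smul_apply, ContinuousLinearMap.id_apply]
    module

end ConformalKilling

/-! ### The conformal Killing fields of the six models. -/

section Models

variable {n : ℕ}

/-- The quadratic vector field `a + c y + B y + ⟨β, y⟩ y - |y|² β / 2`, which is conformal Killing when
`B` is skew. -/
noncomputable def confField (a : E n) (c : ℝ) (B : E n →L[ℝ] E n) (β : E n) (y : E n) : E n :=
  a + c • y + B y + inner ℝ β y • y - (‖y‖ ^ 2 / 2) • β

lemma contDiff_confField (a : E n) (c : ℝ) (B : E n →L[ℝ] E n) (β : E n) {m : ℕ∞ω} :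
    ContDiff ℝ m (confField a c B β) :=
  (((contDiff_const.add (contDiff_id.const_smul c)).add B.contDiff).add
    ((contDiff_const.inner ℝ contDiff_id).smul contDiff_id)).sub
    (((contDiff_norm_sq ℝ).div_const 2).smul contDiff_const)

lemma fderiv_confField (a : E n) (c : ℝ) (B : E n →L[ℝ] E n) (β y z : E n) :
    fderiv ℝ (confField a c B β) y z =
      c • z + B z + inner ℝ β y • z + inner ℝ β z • y - inner ℝ y z • β := by
  have h1 := ((innerSL ℝ β).hasFDerivAt (x := y)).smul (hasFDerivAt_id y)
  have h2 := ((hasStrictFDerivAt_norm_sq y).hasFDerivAt.mul_const (1 / 2 : ℝ)).smul_const β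
  have h3 := (((((hasFDerivAt_id y).const_smul c).const_add a).add B.hasFDerivAt).add h1).sub h2
  have e : confField a c B β = fun y => a + c • id y + B y + innerSL ℝ β y • id y - (‖y‖ ^ 2 * (1 / 2)) • β := by
    funext y; simp [confField, div_eq_mul_inv]
  have h4 := h3.fderiv
  rw [e]
  refine (congrArg (fun L => L z) h4).trans ?_
  simp
  module

lemma isConformalKilling_confField (a : E n) (c : ℝ) {B : E n →L[ℝ] E n} (hB : ∀ y, inner ℝ (B y) y = 0)
    (β : E n) : IsConformalKilling univ (confField a c B β) (fun y => c + inner ℝ β y) := by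
  intro y _ z
  rw [fderiv_confField]
  simp only [inner_sub_left, inner_add_left, inner_smul_left, hB, real_inner_self_eq_norm_sq]
  simp
  ring

lemma confField_affine (a : E n) (c : ℝ) (B : E n →L[ℝ] E n) (y : E n) :
    confField a c B 0 y = a + c • y + B y := by
  simp [confField]

/-- Shared by the last three models, whose fields all have the form `s ξ + t (⟨ξ, y⟩ y - |y|² ξ /
2)`. -/
lemma inner_confField_axial (s t : ℝ) (ξ y z : E n) :
    inner ℝ (confField (s • ξ) 0 0 (t • ξ) y) z =
      s * inner ℝ ξ z + t * inner ℝ ξ y * inner ℝ y z - ‖y‖ ^ 2 / 2 * t * inner ℝ ξ z := by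
  simp only [confField, zero_smul, zero_apply, add_zero, inner_sub_left, inner_add_left,
    real_inner_smul_left]
  ring

lemma norm_sq_confField_axial (s t : ℝ) (ξ y : E n) :
    ‖confField (s • ξ) 0 0 (t • ξ) y‖ ^ 2 = s ^ 2 * ‖ξ‖ ^ 2 + t ^ 2 * ‖ξ‖ ^ 2 * (‖y‖ ^ 2) ^ 2 / 4 +
      2 * s * t * inner ℝ ξ y ^ 2 - s * t * ‖y‖ ^ 2 * ‖ξ‖ ^ 2 := by
  rw [← real_inner_self_eq_norm_sq, inner_confField_axial, real_inner_comm, real_inner_comm _ y,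
    inner_confField_axial, inner_confField_axial, real_inner_self_eq_norm_sq, real_inner_self_eq_norm_sq,
    real_inner_comm ξ y]
  ring

/-- On the open set `D` the model weight `φ₀` is smooth with gradient `X / |X|²`, where `X` is the conformal
Killing field with the given coefficients. -/
structure HasModelField (D : Set (E n)) (φ₀ : E n → ℝ) (a : E n) (c : ℝ) (B : E n →L[ℝ] E n)
    (β : E n) : Prop where
  model : IsModelWeight D φ₀
  isOpen : IsOpen D
  skew : ∀ y, inner ℝ (B y) y = 0
  smooth : ∀ y ∈ D, ContDiffAt ℝ ∞ φ₀ y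
  ne_zero : ∀ y ∈ D, confField a c B β y ≠ 0
  gradient : ∀ y ∈ D, ∀ z, ‖confField a c B β y‖ ^ 2 * fderiv ℝ φ₀ y z = inner ℝ (confField a c B β y) z

/-- On the slit plane `arg = Im log`, so the derivative is the imaginary part of the logarithmic
derivative. -/
lemma hasFDerivAt_arg_comp {F : E n → ℂ} {F' : E n →L[ℝ] ℂ} {y : E n} (hF : HasFDerivAt F F' y)
    (hy : F y ∈ Complex.slitPlane) :
    HasFDerivAt (fun x => (F x).arg) (Complex.imCLM.comp ((F y)⁻¹ • F')) y := by
  have h1 := ((Complex.hasStrictDerivAt_log hy).hasDerivAt.hasFDerivAt.restrictScalars ℝ).comp y hF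
  have h2 := Complex.imCLM.hasFDerivAt.comp y h1
  refine (h2.congr_of_eventuallyEq (Eventually.of_forall fun x => ?_)).congr_fderiv ?_
  · simp [Complex.log_im]
  · ext z; simp [mul_comm]

lemma contDiffAt_arg_comp {F : E n → ℂ} {y : E n} (hF : ContDiffAt ℝ ∞ F y)
    (hy : F y ∈ Complex.slitPlane) : ContDiffAt ℝ ∞ (fun x => (F x).arg) y := by
  have h1 : ContDiffAt ℝ ∞ Complex.log (F y) := (Complex.contDiffAt_log hy).restrict_scalars ℝ
  have h2 := Complex.imCLM.contDiff.contDiffAt.comp y (h1.comp y hF)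
  exact h2.congr_of_eventuallyEq (Eventually.of_forall fun x => by simp [Complex.log_im])

lemma hasModelField_linear {ξ : E n} (hξ : ξ ≠ 0) :
    HasModelField univ (fun x => inner ℝ x ξ) ((‖ξ‖ ^ 2)⁻¹ • ξ) 0 0 0 := by
  have hne : ‖ξ‖ ≠ 0 := norm_ne_zero_iff.2 hξ
  refine ⟨.linear ξ hξ, isOpen_univ, by simp, fun y _ => contDiffAt_id.inner ℝ contDiffAt_const,
    fun y _ => by simp [confField, hξ], fun y _ z => ?_⟩
  rw [fderiv_inner_apply ℝ differentiableAt_fun_id (differentiableAt_const ξ)]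
  rw [confField_affine, zero_smul, zero_apply, add_zero, add_zero, norm_smul, real_inner_smul_left]
  simp [real_inner_comm ξ z]
  exact Or.inl (by field_simp)

lemma hasModelField_log : HasModelField {x : E n | x ≠ 0} (fun x => Real.log ‖x‖) 0 1 0 0 := by
  refine ⟨.log, isOpen_ne, by simp, fun y hy => (contDiffAt_norm ℝ hy).log (norm_ne_zero_iff.2 hy),
    fun y hy => by simpa [confField] using hy, fun y hy z => ?_⟩
  have hne : ‖y‖ ≠ 0 := norm_ne_zero_iff.2 hy
  have h : HasFDerivAt (fun x : E n => (1 / 2 : ℝ) * Real.log (‖x‖ ^ 2)) _ y :=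
    ((hasStrictFDerivAt_norm_sq y).hasFDerivAt.log (by positivity)).const_mul (1 / 2 : ℝ)
  have e : (fun x : E n => Real.log ‖x‖) = fun x => (1 / 2 : ℝ) * Real.log (‖x‖ ^ 2) := by
    funext x; simp
  rw [e, h.fderiv]
  simp [confField]
  field_simp

/-- The rotation generator `ω₁ ↦ ω₂ ↦ -ω₁`. -/
noncomputable def rotationGenerator (ω₁ ω₂ : E n) : E n →L[ℝ] E n :=
  (innerSL ℝ ω₁).smulRight ω₂ - (innerSL ℝ ω₂).smulRight ω₁

lemma rotationGenerator_apply (ω₁ ω₂ y : E n) :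
    rotationGenerator ω₁ ω₂ y = inner ℝ ω₁ y • ω₂ - inner ℝ ω₂ y • ω₁ := by
  simp [rotationGenerator]

@[simp] lemma complexInner_re (ω₁ ω₂ x : E n) : (complexInner ω₁ ω₂ x).re = inner ℝ x ω₁ := by
  simp [complexInner]

@[simp] lemma complexInner_im (ω₁ ω₂ x : E n) : (complexInner ω₁ ω₂ x).im = inner ℝ x ω₂ := by
  simp [complexInner]

@[simp] lemma complexSquare_re (ξ x : E n) : (complexSquare ξ x).re = ‖x‖ ^ 2 - ‖ξ‖ ^ 2 := by
  simp [complexSquare, -Complex.ofReal_sub]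

@[simp] lemma complexSquare_im (ξ x : E n) : (complexSquare ξ x).im = 2 * inner ℝ x ξ := by
  simp [complexSquare, -Complex.ofReal_sub]

lemma hasFDerivAt_ofReal_inner (ξ y : E n) :
    HasFDerivAt (fun x : E n => ((inner ℝ x ξ : ℝ) : ℂ)) (Complex.ofRealCLM.comp (innerSL ℝ ξ)) y := by
  refine (Complex.ofRealCLM.hasFDerivAt.comp y (innerSL ℝ ξ).hasFDerivAt).congr_of_eventuallyEq
    (Eventually.of_forall fun x => ?_)
  simp [real_inner_comm]

lemma contDiff_ofReal_inner (ξ : E n) : ContDiff ℝ ∞ (fun x : E n => ((inner ℝ x ξ : ℝ) : ℂ)) :=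
  Complex.ofRealCLM.contDiff.comp (contDiff_id.inner ℝ contDiff_const)

lemma hasModelField_argLinear {ω₁ ω₂ : E n} (h₁ : ‖ω₁‖ = 1) (h₂ : ‖ω₂‖ = 1) (h₁₂ : inner ℝ ω₁ ω₂ = 0) :
    HasModelField {x | complexInner ω₁ ω₂ x ∈ Complex.slitPlane} (fun x => (complexInner ω₁ ω₂ x).arg)
      0 0 (rotationGenerator ω₁ ω₂) 0 := by
  have hs : ContDiff ℝ ∞ (complexInner ω₁ ω₂) :=
    (contDiff_ofReal_inner ω₁).add (contDiff_const.mul (contDiff_ofReal_inner ω₂))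
  have hd (y : E n) : HasFDerivAt (complexInner ω₁ ω₂) _ y :=
    (hasFDerivAt_ofReal_inner ω₁ y).add ((hasFDerivAt_ofReal_inner ω₂ y).const_mul Complex.I)
  have hn (y : E n) : ‖confField 0 0 (rotationGenerator ω₁ ω₂) 0 y‖ ^ 2 =
      Complex.normSq (complexInner ω₁ ω₂ y) := by
    rw [confField_affine, rotationGenerator_apply]
    simp only [zero_smul, zero_add, norm_sub_sq_real, real_inner_smul_left, real_inner_smul_right, norm_smul, mul_pow, Real.norm_eq_abs,
      sq_abs, h₁, h₂, h₁₂, real_inner_comm ω₁ ω₂, Complex.normSq_apply, complexInner_re, complexInner_im,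
      real_inner_comm y]
    ring
  refine ⟨.argLinear ω₁ ω₂ h₁ h₂ h₁₂, Complex.isOpen_slitPlane.preimage hs.continuous, fun y => ?_,
    fun y hy => contDiffAt_arg_comp hs.contDiffAt hy, fun y hy h0 => ?_, fun y hy z => ?_⟩
  · rw [rotationGenerator_apply, inner_sub_left, inner_smul_left, inner_smul_left]
    simp; ring
  · have := hn y
    rw [h0] at this
    simp only [norm_zero, ne_eq, OfNat.ofNat_ne_zero, not_false_eq_true, zero_pow] at this
    exact Complex.slitPlane_ne_zero hy (Complex.normSq_eq_zero.1 this.symm)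
  · have hne : Complex.normSq (complexInner ω₁ ω₂ y) ≠ 0 :=
      fun h => Complex.slitPlane_ne_zero hy (Complex.normSq_eq_zero.1 h)
    rw [(hasFDerivAt_arg_comp (hd y) hy).fderiv, hn]
    simp [Complex.inv_re, Complex.inv_im]
    field_simp
    simp only [confField_affine, rotationGenerator_apply, zero_smul, zero_add, inner_sub_left, real_inner_smul_left, real_inner_comm y]
    ring

lemma hasModelField_inverted {ξ : E n} (hξ : ξ ≠ 0) :
    HasModelField {x | x ≠ 0} (fun x => inner ℝ x ξ / ‖x‖ ^ 2) ((0 : ℝ) • ξ) 0 0 ((-2 * (‖ξ‖ ^ 2)⁻¹) • ξ) := by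
  have hξ' : ‖ξ‖ ≠ 0 := norm_ne_zero_iff.2 hξ
  have hn (y : E n) : ‖confField ((0 : ℝ) • ξ) 0 0 ((-2 * (‖ξ‖ ^ 2)⁻¹) • ξ) y‖ ^ 2 = (‖y‖ ^ 2) ^ 2 / ‖ξ‖ ^ 2 := by
    rw [norm_sq_confField_axial]
    field_simp
    ring
  refine ⟨.inverted ξ hξ, isOpen_ne, by simp, fun y hy => ?_, fun y hy h0 => ?_, fun y hy z => ?_⟩
  · exact (contDiffAt_id.inner ℝ contDiffAt_const).div (contDiff_norm_sq ℝ).contDiffAt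
      (pow_ne_zero 2 (norm_ne_zero_iff.2 hy))
  · have := hn y
    rw [h0] at this
    have hy' : ‖y‖ ≠ 0 := norm_ne_zero_iff.2 hy
    have : 0 < (‖y‖ ^ 2) ^ 2 / ‖ξ‖ ^ 2 := by positivity
    simp_all
  · have hy' : ‖y‖ ≠ 0 := norm_ne_zero_iff.2 hy
    have h := ((innerSL ℝ ξ).hasFDerivAt (x := y)).mul
      ((hasDerivAt_inv (pow_ne_zero 2 hy')).comp_hasFDerivAt y (hasStrictFDerivAt_norm_sq y).hasFDerivAt)
    have e : (fun x : E n => inner ℝ x ξ / ‖x‖ ^ 2) = fun x => innerSL ℝ ξ x * (‖x‖ ^ 2)⁻¹ := by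
      funext x; simp [real_inner_comm, div_eq_mul_inv]
    have h' := congrArg (fun L => L z) h.fderiv
    rw [hn, e, inner_confField_axial]
    refine (congrArg (fun t => (‖y‖ ^ 2) ^ 2 / ‖ξ‖ ^ 2 * t) h').trans ?_
    simp
    field_simp

/-- The field vanishes exactly where `(y + iξ)² = 0`, a set disjoint from the domain of the model.
-/
lemma norm_sq_confField_argSquare {ξ : E n} (hξ : ξ ≠ 0) (y : E n) :
    ‖confField ((-1 / 2 : ℝ) • ξ) 0 0 ((-(‖ξ‖ ^ 2)⁻¹) • ξ) y‖ ^ 2 =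
      Complex.normSq (complexSquare ξ y) / (4 * ‖ξ‖ ^ 2) := by
  have hξ' : ‖ξ‖ ≠ 0 := norm_ne_zero_iff.2 hξ
  rw [norm_sq_confField_axial, Complex.normSq_apply, complexSquare_re, complexSquare_im, real_inner_comm ξ y]
  field_simp
  ring

lemma hasModelField_argSquare {θ : ℝ} (hθ : θ ∈ Ico 0 (2 * Real.pi)) {ξ : E n} (hξ : ξ ≠ 0) :
    HasModelField {x | Complex.exp (θ * Complex.I) * complexSquare ξ x ∈ Complex.slitPlane}
      (fun x => (Complex.exp (θ * Complex.I) * complexSquare ξ x).arg)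
      ((-1 / 2 : ℝ) • ξ) 0 0 ((-(‖ξ‖ ^ 2)⁻¹) • ξ) := by
  have hξ' : ‖ξ‖ ≠ 0 := norm_ne_zero_iff.2 hξ
  have hs : ContDiff ℝ ∞ (fun x => Complex.exp (θ * Complex.I) * complexSquare ξ x) :=
    contDiff_const.mul ((Complex.ofRealCLM.contDiff.comp ((contDiff_norm_sq ℝ).sub contDiff_const)).add
      (contDiff_const.mul (contDiff_ofReal_inner ξ)))
  have hd (y : E n) : HasFDerivAt (fun x => Complex.exp (θ * Complex.I) * complexSquare ξ x) _ y :=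
    ((Complex.ofRealCLM.hasFDerivAt.comp y
      ((hasStrictFDerivAt_norm_sq y).hasFDerivAt.sub_const (‖ξ‖ ^ 2))).add
      ((hasFDerivAt_ofReal_inner ξ y).const_mul (2 * Complex.I))).const_mul (Complex.exp (θ * Complex.I))
  have hn := norm_sq_confField_argSquare hξ
  have hz {y : E n} (hy : Complex.exp (θ * Complex.I) * complexSquare ξ y ∈ Complex.slitPlane) :
      complexSquare ξ y ≠ 0 := right_ne_zero_of_mul (Complex.slitPlane_ne_zero hy)
  refine ⟨.argSquare θ hθ ξ hξ, Complex.isOpen_slitPlane.preimage hs.continuous, by simp,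
    fun y hy => contDiffAt_arg_comp hs.contDiffAt hy, fun y hy h0 => ?_, fun y hy z => ?_⟩
  · have := hn y
    have h1 : 0 < Complex.normSq (complexSquare ξ y) := Complex.normSq_pos.2 (hz hy)
    rw [h0] at this
    have : 0 < Complex.normSq (complexSquare ξ y) / (4 * ‖ξ‖ ^ 2) := by positivity
    simp_all
  · have h1 : Complex.normSq (complexSquare ξ y) ≠ 0 := (Complex.normSq_pos.2 (hz hy)).ne'
    rw [(hasFDerivAt_arg_comp (hd y) hy).fderiv, hn, inner_confField_axial]
    -- The constant phase cancels in the logarithmic derivative, so the field does not depend on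
    -- `θ`.
    have e : (Complex.exp (θ * Complex.I) * complexSquare ξ y)⁻¹ * Complex.exp (θ * Complex.I) =
        (complexSquare ξ y)⁻¹ := by
      have := Complex.exp_ne_zero (θ * Complex.I)
      have := hz hy
      field_simp
    simp only [ContinuousLinearMap.comp_apply, smul_apply, smul_smul, e]
    simp [Complex.inv_re, Complex.inv_im]
    field_simp
    rw [real_inner_comm ξ y]
    ring

/-- The zeros of the field are exactly the two poles `±ξ` of the weight. -/
lemma norm_sq_confField_logRatio {ξ : E n} (hξ : ξ ≠ 0) (y : E n) :
    ‖confField ((1 / 4 : ℝ) • ξ) 0 0 ((-(1 / 2) * (‖ξ‖ ^ 2)⁻¹) • ξ) y‖ ^ 2 =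
      ‖y + ξ‖ ^ 2 * ‖y - ξ‖ ^ 2 / (16 * ‖ξ‖ ^ 2) := by
  have hξ' : ‖ξ‖ ≠ 0 := norm_ne_zero_iff.2 hξ
  rw [norm_sq_confField_axial, norm_add_sq_real, norm_sub_sq_real, real_inner_comm ξ y]
  field_simp
  ring

lemma hasModelField_logRatio {ξ : E n} (hξ : ξ ≠ 0) :
    HasModelField {x | x ≠ ξ ∧ x ≠ -ξ} (fun x => Real.log (‖x + ξ‖ ^ 2 / ‖x - ξ‖ ^ 2))
      ((1 / 4 : ℝ) • ξ) 0 0 ((-(1 / 2) * (‖ξ‖ ^ 2)⁻¹) • ξ) := by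
  have hξ' : ‖ξ‖ ≠ 0 := norm_ne_zero_iff.2 hξ
  have hn := norm_sq_confField_logRatio hξ
  have hp {y : E n} (hy : y ≠ ξ ∧ y ≠ -ξ) : 0 < ‖y + ξ‖ ^ 2 ∧ 0 < ‖y - ξ‖ ^ 2 := by
    have h1 : 0 < ‖y - ξ‖ := norm_pos_iff.2 (sub_ne_zero.2 hy.1)
    have h2 : 0 < ‖y + ξ‖ := norm_pos_iff.2 (by rw [← sub_neg_eq_add]; exact sub_ne_zero.2 hy.2)
    exact ⟨by positivity, by positivity⟩
  have hD : IsOpen {x : E n | x ≠ ξ ∧ x ≠ -ξ} := isOpen_ne.inter isOpen_ne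
  refine ⟨.logRatio ξ hξ, hD, by simp, fun y hy => ?_, fun y hy h0 => ?_, fun y hy z => ?_⟩
  · obtain ⟨h1, h2⟩ := hp hy
    exact (((contDiffAt_id.add contDiffAt_const).norm_sq ℝ).div
      ((contDiffAt_id.sub contDiffAt_const).norm_sq ℝ) h2.ne').log (div_pos h1 h2).ne'
  · obtain ⟨h1, h2⟩ := hp hy
    have := hn y
    rw [h0] at this
    have : 0 < ‖y + ξ‖ ^ 2 * ‖y - ξ‖ ^ 2 / (16 * ‖ξ‖ ^ 2) := by positivity
    simp_all
  · obtain ⟨h1, h2⟩ := hp hy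
    have e : (fun x => Real.log (‖x + ξ‖ ^ 2 / ‖x - ξ‖ ^ 2)) =ᶠ[𝓝 y]
        fun x => Real.log (‖x + ξ‖ ^ 2) - Real.log (‖x - ξ‖ ^ 2) := by
      filter_upwards [hD.mem_nhds hy] with x hx
      exact Real.log_div (hp hx).1.ne' (hp hx).2.ne'
    have h := (((hasFDerivAt_id y).add_const ξ).norm_sq.log h1.ne').sub
      (((hasFDerivAt_id y).sub_const ξ).norm_sq.log h2.ne')
    rw [hn, e.fderiv_eq, inner_confField_axial]
    refine (congrArg (fun t => ‖y + ξ‖ ^ 2 * ‖y - ξ‖ ^ 2 / (16 * ‖ξ‖ ^ 2) * t)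
      (congrArg (fun L => L z) h.fderiv)).trans ?_
    have h1' : ‖y + ξ‖ ≠ 0 := by rintro h; simp [h] at h1
    have h2' : ‖y - ξ‖ ≠ 0 := by rintro h; simp [h] at h2
    simp
    field_simp
    rw [norm_add_sq_real, norm_sub_sq_real, real_inner_comm ξ y]
    ring

lemma IsModelWeight.exists_hasModelField {D : Set (E n)} {φ₀ : E n → ℝ} (h : IsModelWeight D φ₀) :
    ∃ a c B β, HasModelField D φ₀ a c B β := by
  cases h with
  | linear ξ hξ => exact ⟨_, _, _, _, hasModelField_linear hξ⟩
  | argLinear ω₁ ω₂ h₁ h₂ h₁₂ => exact ⟨_, _, _, _, hasModelField_argLinear h₁ h₂ h₁₂⟩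
  | log => exact ⟨_, _, _, _, hasModelField_log⟩
  | inverted ξ hξ => exact ⟨_, _, _, _, hasModelField_inverted hξ⟩
  | argSquare θ hθ ξ hξ => exact ⟨_, _, _, _, hasModelField_argSquare hθ hξ⟩
  | logRatio ξ hξ => exact ⟨_, _, _, _, hasModelField_logRatio hξ⟩

end Models

/-! ### Algebraic classification of the quadratic fields with integrable complement. -/

section Classification

variable {n : ℕ} {a β : E n} {c : ℝ} {B : E n →L[ℝ] E n}

/-- The skew part of the derivative of `confField a c B β` at `h`, as a bilinear form. -/
noncomputable def skewPart (B : E n →L[ℝ] E n) (β h y z : E n) : ℝ :=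
  inner ℝ (B y) z + inner ℝ β y * inner ℝ h z - inner ℝ h y * inner ℝ β z

/-- The wedge product of the skew part of the derivative of `confField a c B β` with the field itself vanishes,
i.e. the hyperplane distribution orthogonal to the field is integrable. -/
def HasIntegrableComplement (a : E n) (c : ℝ) (B : E n →L[ℝ] E n) (β : E n) : Prop :=
  ∀ h u v w, skewPart B β h u v * inner ℝ (confField a c B β h) w +
    skewPart B β h v w * inner ℝ (confField a c B β h) u +
    skewPart B β h w u * inner ℝ (confField a c B β h) v = 0

lemma inner_skew_comm (hB : ∀ y, inner ℝ (B y) y = 0) (u v : E n) :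
    inner ℝ (B u) v = -inner ℝ (B v) u := by
  have h := hB (u + v)
  rw [map_add, inner_add_left, inner_add_right, inner_add_right, hB, hB] at h
  linarith

lemma inner_rotationGenerator_self (ω₁ ω₂ y : E n) : inner ℝ (rotationGenerator ω₁ ω₂ y) y = 0 := by
  rw [rotationGenerator_apply, inner_sub_left, real_inner_smul_left, real_inner_smul_left]
  ring

/-- Moving the origin keeps `β` but changes `c` and `B`; this freedom is used to normalize them when
`β ≠ 0`. -/
lemma confField_add (a : E n) (c : ℝ) (B : E n →L[ℝ] E n) (β x₀ y : E n) :
    confField a c B β (x₀ + y) = confField (confField a c B β x₀) (c + inner ℝ β x₀)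
      (B + rotationGenerator β x₀) β y := by
  simp only [confField, map_add, inner_add_right, add_apply, rotationGenerator_apply, norm_add_sq_real]
  module

lemma HasIntegrableComplement.translate (h : HasIntegrableComplement a c B β) (x₀ : E n) :
    HasIntegrableComplement (confField a c B β x₀) (c + inner ℝ β x₀) (B + rotationGenerator β x₀) β := by
  have e (y u v : E n) : skewPart (B + rotationGenerator β x₀) β y u v = skewPart B β (x₀ + y) u v := by
    simp only [skewPart, add_apply, rotationGenerator_apply, inner_add_left, inner_sub_left,
      real_inner_smul_left]
    ring
  intro y u v w
  rw [e, e, e, ← confField_add]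
  exact h _ u v w

lemma smul_confField_axial (k s t : ℝ) (ξ y : E n) :
    k • confField (s • ξ) 0 0 (t • ξ) y = confField ((k * s) • ξ) 0 0 ((k * t) • ξ) y := by
  simp only [confField, real_inner_smul_left, zero_smul, zero_apply]
  module

/-- After centering, the field is symmetric around the axis `β`. -/
lemma HasIntegrableComplement.axial (hn : 3 ≤ n) (h : HasIntegrableComplement a 0 B β)
    (hB : ∀ y, inner ℝ (B y) y = 0) (hβ : β ≠ 0) (hBβ : B β = 0) : B = 0 ∧ ∃ s : ℝ, a = s • β := by
  have hβ' : ‖β‖ ≠ 0 := norm_ne_zero_iff.2 hβ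
  have hB0 : B = 0 := by
    ext1 y
    refine ext_inner_right ℝ fun z => ?_
    -- At both base points the condition reads `⟨B y, z⟩ ⟨X, β⟩ = 0`, and the two values of `⟨X, β⟩`
    -- differ by `|β|⁴ / 2`.
    have h0 := h 0 β y z
    have h1 := h β β y z
    have e1 : confField a 0 B β 0 = a := by simp [confField]
    have e2 : confField a 0 B β β = a + (‖β‖ ^ 2 / 2) • β := by
      simp only [confField, hBβ, real_inner_self_eq_norm_sq]; module
    have e3 := inner_skew_comm hB z β
    rw [hBβ, inner_zero_left, neg_zero] at e3
    rw [e1] at h0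
    rw [e2] at h1
    simp only [skewPart, hBβ, inner_zero_left, inner_add_left, real_inner_smul_left,
      real_inner_self_eq_norm_sq, e3] at h0 h1
    have h2 : (‖β‖ ^ 2) ^ 2 * inner ℝ (B y) z = 0 := by linear_combination 2 * h1 - 2 * h0
    rw [zero_apply, inner_zero_left]
    exact (mul_eq_zero.1 h2).resolve_left (by positivity)
  refine ⟨hB0, inner ℝ a β / ‖β‖ ^ 2, ?_⟩
  set s := inner ℝ a β / ‖β‖ ^ 2 with hs
  have hperp : inner ℝ (a - s • β) β = 0 := by
    rw [inner_sub_left, real_inner_smul_left, real_inner_self_eq_norm_sq, hs]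
    field_simp; ring
  -- With base point `y` and triple `(β, y, a - s β)`, only `|β|² |a - s β|²` survives, where `a - s
  -- β` is the part of `a` off the axis.
  obtain ⟨y, hy, hβy, hay⟩ := exists_unit_orthogonal (V := E n) (by simpa using hn) β (a - s • β)
  have h1 := h y β y (a - s • β)
  have hay' : inner ℝ y (a - s • β) = 0 := by rw [real_inner_comm, hay]
  have hperp' : inner ℝ β (a - s • β) = 0 := by rw [real_inner_comm, hperp]
  have hyβ : inner ℝ y β = 0 := by rw [real_inner_comm, hβy]
  simp only [skewPart, hB0, zero_apply, inner_zero_left, hβy, hay', hperp', hyβ,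
    real_inner_self_eq_norm_sq, hy] at h1
  have h2 : inner ℝ (confField a 0 0 β y) (a - s • β) = ‖a - s • β‖ ^ 2 := by
    rw [← real_inner_self_eq_norm_sq]
    simp only [confField, hβy, zero_smul, zero_apply, add_zero, inner_sub_left a,
      real_inner_smul_left, hperp']
    ring
  rw [h2] at h1
  have h3 : ‖β‖ ^ 2 * ‖a - s • β‖ ^ 2 = 0 := by linear_combination h1
  have h4 : ‖a - s • β‖ = 0 := by
    simpa [hβ'] using h3
  exact sub_eq_zero.1 (norm_eq_zero.1 h4)

/-- Turn `z` onto the positive real axis. This is why the phase `θ` is needed in the model: some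
branch is defined at every nonzero `z`. -/
lemma exists_exp_mul_mem_slitPlane {z : ℂ} (hz : z ≠ 0) :
    ∃ θ ∈ Ico 0 (2 * Real.pi), Complex.exp ((θ : ℝ) * Complex.I) * z ∈ Complex.slitPlane := by
  have key (θ : ℝ) (h : Complex.exp (θ * Complex.I) = Complex.exp (-(z.arg * Complex.I))) :
      Complex.exp (θ * Complex.I) * z ∈ Complex.slitPlane := by
    have e : Complex.exp (θ * Complex.I) * z = (‖z‖ : ℝ) := by
      conv_lhs => rw [h, ← Complex.norm_mul_exp_arg_mul_I z]
      rw [mul_left_comm, ← Complex.exp_add]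
      simp
    rw [e]
    exact Complex.ofReal_mem_slitPlane.2 (norm_pos_iff.2 hz)
  have h1 := Complex.neg_pi_lt_arg z
  have h2 := Complex.arg_le_pi z
  have h3 := Real.pi_pos
  rcases le_or_gt z.arg 0 with h | h
  · exact ⟨-z.arg, ⟨by linarith, by linarith⟩, key _ (by simp)⟩
  · refine ⟨2 * Real.pi - z.arg, ⟨by linarith, by linarith⟩, key _ ?_⟩
    push_cast
    rw [sub_mul, sub_eq_add_neg, Complex.exp_add, Complex.exp_two_pi_mul_I, one_mul]

/-- The field `X` is, up to scaling and translation, the field of a model weight defined at `0`. -/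
def IsModelLike (X : E n → E n) : Prop :=
  ∃ (D : Set (E n)) (φ₀ : E n → ℝ) (a : E n) (c : ℝ) (B : E n →L[ℝ] E n) (β x₀ : E n) (k : ℝ),
    HasModelField D φ₀ a c B β ∧ k ≠ 0 ∧ -x₀ ∈ D ∧ ∀ h, X h = k • confField a c B β (h - x₀)

/-- The zeros of `s β + ⟨β, y⟩ y - |y|² β / 2` tell the models apart: two points on the axis for `s
< 0`, the origin for `s = 0`, the sphere `|y|² = 2s` in `β⊥` for `s > 0`. The scale `τ` puts the
zeros of the model with `ξ = τ β` at the same place, and `X 0 ≠ 0` puts `-x₀` in its domain. -/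
lemma isModelLike_axial {X : E n → E n} (h0 : X 0 ≠ 0) (hβ : β ≠ 0) {s : ℝ} {x₀ : E n}
    (hX : ∀ h, X h = confField (s • β) 0 0 β (h - x₀)) : IsModelLike X := by
  have hβ' : 0 < ‖β‖ := norm_pos_iff.2 hβ
  have aux {k s' t' τ : ℝ} (h1 : k * s' * τ = s) (h2 : k * t' * τ = 1) (h : E n) :
      X h = k • confField (s' • τ • β) 0 0 (t' • τ • β) (h - x₀) := by
    rw [smul_confField_axial, smul_smul, smul_smul, h1, h2, one_smul, hX]
  have aux0 {k : ℝ} {a' : E n} {β' : E n} (h : ∀ h, X h = k • confField a' 0 0 β' (h - x₀)) :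
      confField a' 0 0 β' (-x₀) ≠ 0 := by
    intro h'
    apply h0
    rw [h, zero_sub, h', smul_zero]
  rcases lt_trichotomy s 0 with hs | hs | hs
  · obtain ⟨τ, hτ, hτs⟩ : ∃ τ : ℝ, 0 < τ ∧ s = -(1 / 2) * τ ^ 2 * ‖β‖ ^ 2 := by
      refine ⟨√(-2 * s) / ‖β‖, div_pos (Real.sqrt_pos.2 (by linarith)) hβ', ?_⟩
      rw [div_pow, Real.sq_sqrt (by linarith)]; field_simp
    have hξ : τ • β ≠ 0 := smul_ne_zero hτ.ne' hβ
    have hξn : ‖τ • β‖ ^ 2 = τ ^ 2 * ‖β‖ ^ 2 := by rw [norm_smul, mul_pow, Real.norm_eq_abs, sq_abs]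
    have hk := aux (k := -2 * τ * ‖β‖ ^ 2) (s' := 1 / 4) (t' := -(1 / 2) * (‖τ • β‖ ^ 2)⁻¹) (τ := τ)
      (by rw [hτs]; ring) (by rw [hξn]; field_simp)
    refine ⟨_, _, _, _, _, _, x₀, _, hasModelField_logRatio hξ, ?_, ?_, hk⟩
    · exact mul_ne_zero (mul_ne_zero (by norm_num) hτ.ne') (by positivity)
    · have h1 := norm_sq_confField_logRatio hξ (-x₀)
      have h2 := norm_ne_zero_iff.2 (aux0 hk)
      constructor <;> intro h3 <;> rw [h3] at h1 h2 <;> simp at h1 <;> exact h2 (by simpa using h1)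
  · have hk := aux (k := -‖β‖ ^ 2 / 2) (s' := 0) (t' := -2 * (‖β‖ ^ 2)⁻¹) (τ := 1)
      (by rw [hs]; ring) (by field_simp)
    simp only [one_smul] at hk
    refine ⟨_, _, _, _, _, _, x₀, _, hasModelField_inverted hβ, ?_, ?_, hk⟩
    · exact div_ne_zero (neg_ne_zero.2 (by positivity)) (by norm_num)
    · intro h
      apply aux0 hk
      rw [h]; simp [confField]
  · obtain ⟨τ, hτ, hτs⟩ : ∃ τ : ℝ, 0 < τ ∧ s = (1 / 2) * τ ^ 2 * ‖β‖ ^ 2 := by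
      refine ⟨√(2 * s) / ‖β‖, div_pos (Real.sqrt_pos.2 (by linarith)) hβ', ?_⟩
      rw [div_pow, Real.sq_sqrt (by linarith)]; field_simp
    have hξ : τ • β ≠ 0 := smul_ne_zero hτ.ne' hβ
    have hξn : ‖τ • β‖ ^ 2 = τ ^ 2 * ‖β‖ ^ 2 := by rw [norm_smul, mul_pow, Real.norm_eq_abs, sq_abs]
    have hk := aux (k := -τ * ‖β‖ ^ 2) (s' := -1 / 2) (t' := -(‖τ • β‖ ^ 2)⁻¹) (τ := τ)
      (by rw [hτs]; ring) (by rw [hξn]; field_simp)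
    have hz : complexSquare (τ • β) (-x₀) ≠ 0 := by
      intro h
      have h1 := norm_sq_confField_argSquare hξ (-x₀)
      rw [h] at h1
      exact norm_ne_zero_iff.2 (aux0 hk) (by simpa using h1)
    obtain ⟨θ, hθ, hmem⟩ := exists_exp_mul_mem_slitPlane hz
    exact ⟨_, _, _, _, _, _, x₀, _, hasModelField_argSquare hθ hξ,
      mul_ne_zero (neg_ne_zero.2 hτ.ne') (by positivity), hmem, hk⟩

lemma isModelLike_rotation (hn : 3 ≤ n) (h : HasIntegrableComplement a c B 0)
    (hB : ∀ y, inner ℝ (B y) y = 0) (ha : a ≠ 0) (hB0 : B ≠ 0) : IsModelLike (confField a c B 0) := by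
  have ha' : ‖a‖ ≠ 0 := norm_ne_zero_iff.2 ha
  have hW (x u v w : E n) : inner ℝ (B u) v * inner ℝ (a + c • x + B x) w +
      inner ℝ (B v) w * inner ℝ (a + c • x + B x) u + inner ℝ (B w) u * inner ℝ (a + c • x + B x) v = 0 := by
    have := h x u v w
    simpa only [skewPart, confField_affine, inner_zero_left, zero_mul, mul_zero, add_zero, sub_zero] using this
  set q := B a with hq
  have hqa : inner ℝ q a = 0 := hB a
  have haq : inner ℝ a q = 0 := by rw [real_inner_comm, hqa]
  -- The condition at the origin with first vector `a` forces `B` to act in the plane of `a` and `q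
  -- = B a`.
  have hBv (v : E n) : B v = (inner ℝ a v / ‖a‖ ^ 2) • q - (inner ℝ q v / ‖a‖ ^ 2) • a := by
    refine ext_inner_right ℝ fun w => ?_
    have h1 := hW 0 a v w
    rw [smul_zero, map_zero, add_zero, add_zero, ← hq, inner_skew_comm hB w a, ← hq,
      real_inner_self_eq_norm_sq] at h1
    rw [inner_sub_left, real_inner_smul_left, real_inner_smul_left]
    field_simp
    linear_combination h1
  have hq0 : q ≠ 0 := by
    intro h0
    apply hB0
    ext1 v
    rw [hBv, h0]; simp
  have hq' : ‖q‖ ≠ 0 := norm_ne_zero_iff.2 hq0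
  -- For a unit `e` orthogonal to `a` and `q`, base point `e` and triple `(a, q, e)` give `|q|² c =
  -- 0`.
  have hc : c = 0 := by
    obtain ⟨e, he, hae, hqe⟩ := exists_unit_orthogonal (V := E n) (by simpa using hn) a q
    have h1 := hW e a q e
    have hBe : B e = 0 := by rw [hBv, hae, hqe]; simp
    have hqe' := inner_skew_comm hB q e
    rw [hBe, inner_zero_left, neg_zero] at hqe'
    rw [← hq, hBe, hqe', inner_zero_left, inner_add_left, inner_add_left, real_inner_smul_left, hae,
      real_inner_self_eq_norm_sq, real_inner_self_eq_norm_sq, he, inner_zero_left] at h1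
    have h2 : ‖q‖ ^ 2 * c = 0 := by linear_combination h1
    exact (mul_eq_zero.1 h2).resolve_left (by positivity)
  have h₁ : ‖-(‖q‖⁻¹ • q)‖ = 1 := by rw [norm_neg]; exact norm_smul_inv_norm (𝕜 := ℝ) hq0
  have h₂ : ‖‖a‖⁻¹ • a‖ = 1 := norm_smul_inv_norm (𝕜 := ℝ) ha
  have h₁₂ : inner ℝ (-(‖q‖⁻¹ • q)) (‖a‖⁻¹ • a) = 0 := by
    rw [inner_neg_left, real_inner_smul_left, real_inner_smul_right, hqa]; simp
  -- The translation is a zero of `a + B y` and the scale is its angular speed. The sign in `ω₁ = -q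
  -- / |q|` gives `-x₀` positive real part, off the slit.
  refine ⟨_, _, _, _, _, _, (‖a‖ ^ 2 / ‖q‖ ^ 2) • q, ‖q‖ / ‖a‖, hasModelField_argLinear h₁ h₂ h₁₂,
    div_ne_zero hq' ha', ?_, fun x => ?_⟩
  · left
    rw [complexInner_re, inner_neg_neg, real_inner_smul_left, real_inner_smul_right, real_inner_self_eq_norm_sq]
    positivity
  · rw [confField_affine, confField_affine, hc, hBv, rotationGenerator_apply]
    simp only [inner_neg_left, real_inner_smul_left, inner_sub_right, real_inner_smul_right,
      real_inner_self_eq_norm_sq, haq, zero_smul, add_zero, zero_add]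
    match_scalars <;> field_simp <;> ring

lemma isModelLike_of_integrable (hn : 3 ≤ n) (h : HasIntegrableComplement a c B β)
    (hB : ∀ y, inner ℝ (B y) y = 0) (ha : a ≠ 0) : IsModelLike (confField a c B β) := by
  by_cases hβ : β = 0
  · subst hβ
    by_cases hB0 : B = 0
    · subst hB0
      by_cases hc : c = 0
      · subst hc
        refine ⟨_, _, _, _, _, _, 0, ‖a‖ ^ 2, hasModelField_linear ha, by simpa using ha, mem_univ _,
          fun x => ?_⟩
        have : ‖a‖ ≠ 0 := norm_ne_zero_iff.2 ha
        rw [confField_affine, confField_affine]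
        simp only [zero_smul, zero_apply, add_zero, smul_smul]
        rw [mul_inv_cancel₀ (by positivity), one_smul]
      -- The centre is the zero `-a / c` of the field `a + c y`.
      · refine ⟨_, _, _, _, _, _, -(c⁻¹ • a), c, hasModelField_log, hc, ?_, fun x => ?_⟩
        · simpa [hc] using ha
        · rw [confField_affine, confField_affine]
          simp [smul_smul, hc, add_comm]
    · exact isModelLike_rotation hn h hB ha hB0
  · have hβ' : ‖β‖ ≠ 0 := norm_ne_zero_iff.2 hβ
    have hβB : inner ℝ β (B β) = 0 := by rw [real_inner_comm, hB]
    -- The new origin solves `⟨β, x₀⟩ = -c` and `B β + |β|² x₀ - ⟨x₀, β⟩ β = 0`: it removes the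
    -- dilation and makes the new skew part kill `β`.
    set x₀ : E n := (-(‖β‖ ^ 2)⁻¹) • B β + (-c / ‖β‖ ^ 2) • β with hx₀
    have e1 : inner ℝ β x₀ = -c := by
      rw [hx₀, inner_add_right, real_inner_smul_right, real_inner_smul_right, hβB, real_inner_self_eq_norm_sq]
      field_simp; ring
    have e2 : (B + rotationGenerator β x₀) β = 0 := by
      rw [add_apply, rotationGenerator_apply, real_inner_comm β x₀, e1, real_inner_self_eq_norm_sq, hx₀]
      match_scalars <;> field_simp <;> ring
    have h' := h.translate x₀
    rw [e1, add_neg_cancel] at h'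
    obtain ⟨hB', s, hs⟩ := h'.axial hn
      (fun y => by rw [add_apply, inner_add_left, hB, inner_rotationGenerator_self, add_zero]) hβ e2
    refine isModelLike_axial (s := s) (x₀ := x₀) (by simpa [confField] using ha) hβ fun x => ?_
    conv_lhs => rw [← add_sub_cancel x₀ x]
    rw [confField_add, e1, add_neg_cancel, hB', hs]

end Classification

/-! ### From weights to fields and back. -/

section Equivalence

variable {n : ℕ} {φ : E n → ℝ} {x : E n}

lemma differentiableAt_invert {Y : E n → E n} (hY : DifferentiableAt ℝ Y x) (h0 : Y x ≠ 0) :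
    DifferentiableAt ℝ (fun y => (‖Y y‖ ^ 2)⁻¹ • Y y) x :=
  ((hY.norm_sq ℝ).inv (pow_ne_zero 2 (norm_ne_zero_iff.2 h0))).smul hY

lemma fderiv_invert {Y : E n → E n} (hY : DifferentiableAt ℝ Y x) (h0 : Y x ≠ 0) (z : E n) :
    fderiv ℝ (fun y => (‖Y y‖ ^ 2)⁻¹ • Y y) x z =
      (‖Y x‖ ^ 2)⁻¹ • fderiv ℝ Y x z - (2 * inner ℝ (fderiv ℝ Y x z) (Y x) / (‖Y x‖ ^ 2) ^ 2) • Y x := by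
  have hne : ‖Y x‖ ^ 2 ≠ 0 := pow_ne_zero 2 (norm_ne_zero_iff.2 h0)
  have h := ((hasDerivAt_inv hne).comp_hasFDerivAt x hY.hasFDerivAt.norm_sq).smul hY.hasFDerivAt
  refine (congrArg (fun L => L z) h.fderiv).trans ?_
  simp [real_inner_comm (Y x)]
  match_scalars <;> field_simp

/-- Rescale `η` to length `|∇φ|`; the Hessian is homogeneous of degree two. -/
lemma hessian_of_carlemanCondition (h0 : gradient φ x ≠ 0)
    (h : ∀ ξ : E n, ‖ξ‖ = ‖gradient φ x‖ → inner ℝ (gradient φ x) ξ = 0 →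
      inner ℝ (fderiv ℝ (gradient φ) x ξ) ξ +
        inner ℝ (fderiv ℝ (gradient φ) x (gradient φ x)) (gradient φ x) = 0)
    {η : E n} (hη : inner ℝ (gradient φ x) η = 0) :
    ‖gradient φ x‖ ^ 2 * inner ℝ (fderiv ℝ (gradient φ) x η) η =
      -‖η‖ ^ 2 * inner ℝ (fderiv ℝ (gradient φ) x (gradient φ x)) (gradient φ x) := by
  by_cases hη0 : η = 0
  · simp [hη0]
  have hη' : ‖η‖ ≠ 0 := norm_ne_zero_iff.2 hη0
  have h1 := h ((‖gradient φ x‖ / ‖η‖) • η)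
    (by rw [norm_smul, norm_div, norm_norm, norm_norm]; field_simp)
    (by rw [inner_smul_right, hη, mul_zero])
  rw [map_smul, real_inner_smul_left, real_inner_smul_right] at h1
  field_simp at h1
  linear_combination h1

/-- With `g = ∇φ` and `H` the Hessian, `⟨DX z, z⟩ = ⟨H z, R z⟩ / |g|²` for the reflection `R` across
`g⊥`. Writing `z = t g + η` with `η ⊥ g`, the mixed terms cancel by symmetry of `H`, and the
Carleman condition relates the remaining two. -/
lemma inner_fderiv_inverted_gradient (hφ : ContDiffAt ℝ ∞ φ x) (h0 : gradient φ x ≠ 0)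
    (h : ∀ ξ : E n, ‖ξ‖ = ‖gradient φ x‖ → inner ℝ (gradient φ x) ξ = 0 →
      inner ℝ (fderiv ℝ (gradient φ) x ξ) ξ +
        inner ℝ (fderiv ℝ (gradient φ) x (gradient φ x)) (gradient φ x) = 0) (z : E n) :
    inner ℝ (fderiv ℝ (fun y => (‖gradient φ y‖ ^ 2)⁻¹ • gradient φ y) x z) z =
      -(inner ℝ (fderiv ℝ (gradient φ) x (gradient φ x)) (gradient φ x)) / (‖gradient φ x‖ ^ 2) ^ 2 *
        ‖z‖ ^ 2 := by
  rw [fderiv_invert ((contDiffAt_gradient hφ).differentiableAt (by simp)) h0]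
  set g := gradient φ x with hg
  have hne : ‖g‖ ≠ 0 := norm_ne_zero_iff.2 h0
  obtain ⟨t, η, hη, rfl⟩ : ∃ (t : ℝ) (η : E n), inner ℝ g η = 0 ∧ z = t • g + η := by
    refine ⟨inner ℝ g z / ‖g‖ ^ 2, z - (inner ℝ g z / ‖g‖ ^ 2) • g, ?_, by abel⟩
    rw [inner_sub_right, real_inner_smul_right, real_inner_self_eq_norm_sq]
    field_simp; ring
  have h1 := hessian_of_carlemanCondition h0 h hη
  have h2 := inner_fderiv_gradient_comm hφ g η
  rw [← hg] at h1
  rw [norm_add_sq_real, norm_smul, mul_pow, Real.norm_eq_abs, sq_abs]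
  simp only [map_add, map_smul, inner_sub_left, inner_add_left, inner_add_right, real_inner_smul_left,
    real_inner_smul_right, real_inner_self_eq_norm_sq, hη, ← h2]
  field_simp
  linear_combination h1

/-- Since `X♭ = |∇φ|⁻² dφ`, its exterior derivative is `d(|∇φ|⁻²) ∧ dφ`, a multiple of `dφ`; hence
`X♭ ∧ dX♭ = 0`. -/
lemma skew_fderiv_inverted_gradient (hφ : ContDiffAt ℝ ∞ φ x) (h0 : gradient φ x ≠ 0) (y z : E n) :
    inner ℝ (fderiv ℝ (fun y => (‖gradient φ y‖ ^ 2)⁻¹ • gradient φ y) x y) z -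
      inner ℝ (fderiv ℝ (fun y => (‖gradient φ y‖ ^ 2)⁻¹ • gradient φ y) x z) y =
    -2 / (‖gradient φ x‖ ^ 2) ^ 2 * (inner ℝ (fderiv ℝ (gradient φ) x y) (gradient φ x) * inner ℝ (gradient φ x) z -
      inner ℝ (fderiv ℝ (gradient φ) x z) (gradient φ x) * inner ℝ (gradient φ x) y) := by
  have hd := (contDiffAt_gradient hφ).differentiableAt (n := ∞) (by simp)
  rw [fderiv_invert hd h0, fderiv_invert hd h0]
  simp only [inner_sub_left, real_inner_smul_left, inner_fderiv_gradient_comm hφ z y]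
  ring

/-- Analytic continuation. The classification evaluates the condition at points that may lie far
outside the original ball. -/
lemma HasIntegrableComplement.of_eventually {a β : E n} {c : ℝ} {B : E n →L[ℝ] E n}
    (h : ∀ᶠ y in 𝓝 (0 : E n), ∀ u v w, skewPart B β y u v * inner ℝ (confField a c B β y) w +
      skewPart B β y v w * inner ℝ (confField a c B β y) u +
      skewPart B β y w u * inner ℝ (confField a c B β y) v = 0) :
    HasIntegrableComplement a c B β := by
  intro y u v w
  have hs (u v : E n) : ContDiff ℝ ω (fun y => skewPart B β y u v) :=
    ((contDiff_const.add (contDiff_const.mul (contDiff_id.inner ℝ contDiff_const))).sub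
      ((contDiff_id.inner ℝ contDiff_const).mul contDiff_const))
  have hc (w : E n) : ContDiff ℝ ω (fun y => inner ℝ (confField a c B β y) w) :=
    (contDiff_confField a c B β).inner ℝ contDiff_const
  have hW := (((hs u v).mul (hc w)).add ((hs v w).mul (hc u))).add ((hs w u).mul (hc v))
  have hA := contDiff_omega_iff_analyticOnNhd.1 hW
  have h0 := hA.eq_of_eventuallyEq (g := fun _ => (0 : ℝ)) analyticOnNhd_const (z₀ := 0)
    (by filter_upwards [h] with y hy using hy u v w)
  exact congrFun h0 y

lemma IsLimitingCarlemanWeight.isModelLike {Ω : Set (E n)} (hn : 3 ≤ n) (hΩ : IsOpen Ω)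
    (hφ : IsLimitingCarlemanWeight Ω φ) (hx : x ∈ Ω) :
    ∃ (r : ℝ) (X : E n → E n), 0 < r ∧ Metric.ball x r ⊆ Ω ∧ IsModelLike X ∧
      ∀ y ∈ Metric.ball x r, ∀ z, ‖X (y - x)‖ ^ 2 * fderiv ℝ φ y z = inner ℝ (X (y - x)) z := by
  obtain ⟨r, hr, hball⟩ := Metric.isOpen_iff.1 hΩ x hx
  have hsm {y : E n} (hy : y ∈ Ω) : ContDiffAt ℝ ∞ φ y := hφ.smooth.contDiffAt (hΩ.mem_nhds hy)
  have hg {y : E n} (hy : y ∈ Ω) : gradient φ y ≠ 0 := fun h => hφ.fderiv_ne_zero y hy (by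
    ext z; rw [← inner_gradient_left (𝕜 := ℝ), h]; simp)
  have hcond {y : E n} (hy : y ∈ Ω) := (carlemanCondition_iff (hsm hy)).1 (hφ.bracket y hy)
  set X : E n → E n := fun y => (‖gradient φ y‖ ^ 2)⁻¹ • gradient φ y with hX
  have hXsm : ContDiffOn ℝ ∞ X (Metric.ball x r) := fun y hy =>
    ((((contDiffAt_gradient (hsm (hball hy))).norm_sq ℝ).inv
      (pow_ne_zero 2 (norm_ne_zero_iff.2 (hg (hball hy))))).smul
      (contDiffAt_gradient (hsm (hball hy)))).contDiffWithinAt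
  have hK : IsConformalKilling (Metric.ball x r) X _ := fun y hy z =>
    inner_fderiv_inverted_gradient (hsm (hball hy)) (hg (hball hy)) (hcond (hball hy)) z
  obtain ⟨β, B, hB, hq⟩ := hK.quadratic hr hXsm (by simpa using hn)
  generalize -(inner ℝ (fderiv ℝ (gradient φ) x (gradient φ x)) (gradient φ x)) / (‖gradient φ x‖ ^ 2) ^ 2 = c at hq
  have hconf {y : E n} (hy : y ∈ Metric.ball x r) : X y = confField (X x) c B β (y - x) := (hq y hy).2
  have hne {y : E n} (hy : y ∈ Metric.ball x r) : ‖gradient φ y‖ ≠ 0 := norm_ne_zero_iff.2 (hg (hball hy))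
  have hskew {y : E n} (hy : y ∈ Metric.ball x r) (u v : E n) : skewPart B β (y - x) u v =
      -(‖gradient φ y‖ ^ 2)⁻¹ * (inner ℝ (fderiv ℝ (gradient φ) y u) (gradient φ y) * inner ℝ (X y) v -
        inner ℝ (fderiv ℝ (gradient φ) y v) (gradient φ y) * inner ℝ (X y) u) := by
    have h1 := skew_fderiv_inverted_gradient (hsm (hball hy)) (hg (hball hy)) u v
    rw [← hX, (hq y hy).1, (hq y hy).1] at h1
    simp only [inner_add_left, inner_sub_left, real_inner_smul_left, inner_skew_comm hB v u,
      real_inner_comm u v] at h1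
    have := hne hy
    simp only [hX, skewPart, real_inner_smul_left, inner_sub_left]
    field_simp
    field_simp at h1
    linear_combination (1 / 2) * h1
  have hint : HasIntegrableComplement (X x) c B β := by
    refine .of_eventually ?_
    have hball0 : Metric.ball (0 : E n) r ∈ 𝓝 0 := Metric.ball_mem_nhds 0 hr
    filter_upwards [hball0] with h hh u v w
    have hy : x + h ∈ Metric.ball x r := by simpa using hh
    have h1 := hconf hy
    have h2 := hskew hy
    rw [add_sub_cancel_left] at h1 h2
    rw [h2, h2, h2, h1]
    ring
  refine ⟨r, confField (X x) c B β, hr, hball, isModelLike_of_integrable hn hint hB ?_, fun y hy z => ?_⟩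
  · exact smul_ne_zero (inv_ne_zero (pow_ne_zero 2 (norm_ne_zero_iff.2 (hg hx)))) (hg hx)
  · rw [← hconf hy, ← inner_gradient_left (𝕜 := ℝ), hX]
    have := hne hy
    simp only [norm_smul, norm_inv, norm_pow, norm_norm, real_inner_smul_left]
    field_simp

lemma IsLimitingCarlemanWeight.isLocallyModelAt {Ω : Set (E n)} (hn : 3 ≤ n) (hΩ : IsOpen Ω)
    (hφ : IsLimitingCarlemanWeight Ω φ) (hx : x ∈ Ω) : IsLocallyModelAt φ x := by
  obtain ⟨r, X, hr, hball, ⟨D, φ₀, a, c, B, β, x₀, k, hM, hk, hxD, hX⟩, hgrad⟩ := hφ.isModelLike hn hΩ hx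
  have hD : (fun y => y - (x + x₀)) ⁻¹' D ∈ 𝓝 x := by
    refine (hM.isOpen.preimage (continuous_sub_right _)).mem_nhds ?_
    simpa using hxD
  obtain ⟨s, hs, hsD⟩ := Metric.mem_nhds_iff.1 hD
  set ρ := min r s
  have hρ : 0 < ρ := lt_min hr hs
  have hd₀ {y : E n} (hy : y - (x + x₀) ∈ D) : HasFDerivAt (fun y => k⁻¹ * φ₀ (y - (x + x₀)) +
      (φ x - k⁻¹ * φ₀ (-x₀))) (k⁻¹ • fderiv ℝ φ₀ (y - (x + x₀))) y := by
    have h1 : HasFDerivAt φ₀ (fderiv ℝ φ₀ (y - (x + x₀))) (y - (x + x₀)) :=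
      ((hM.smooth _ hy).differentiableAt (by simp)).hasFDerivAt
    have h2 := h1.comp y ((hasFDerivAt_id y).sub_const (x + x₀))
    exact (h2.const_mul k⁻¹).add_const (φ x - k⁻¹ * φ₀ (-x₀))
  -- If `X = k X₀`, then `X / |X|² = k⁻¹ X₀ / |X₀|²`, so the two gradients agree on the ball; the
  -- additive constant matches the values at `x`.
  have heq : EqOn φ (fun y => k⁻¹ * φ₀ (y - (x + x₀)) + (φ x - k⁻¹ * φ₀ (-x₀))) (Metric.ball x ρ) := by
    refine IsOpen.eqOn_of_fderiv_eq (𝕜 := ℝ) Metric.isOpen_ball (convex_ball x ρ).isPreconnected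
      (fun y hy => ?_) (fun y hy => ?_) (fun y hy => ?_) (Metric.mem_ball_self hρ) (by simp)
    · exact (differentiableAt_of_smoothOn hΩ hφ.smooth
        (hball (Metric.ball_subset_ball (min_le_left r s) hy))).differentiableWithinAt
    · exact (hd₀ (hsD (Metric.ball_subset_ball (min_le_right r s) hy))).differentiableAt.differentiableWithinAt
    · have hyD : y - (x + x₀) ∈ D := hsD (Metric.ball_subset_ball (min_le_right r s) hy)
      rw [(hd₀ hyD).fderiv]
      ext z
      have h1 := hgrad y (Metric.ball_subset_ball (min_le_left r s) hy) z
      have h2 := hM.gradient _ hyD z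
      have h3 := norm_ne_zero_iff.2 (hM.ne_zero _ hyD)
      rw [hX, sub_sub, norm_smul, mul_pow, Real.norm_eq_abs, sq_abs, real_inner_smul_left, ← h2] at h1
      rw [smul_apply, smul_eq_mul]
      field_simp at h1 ⊢
      linear_combination h1
  refine ⟨D, φ₀, hM.model, k⁻¹, φ x - k⁻¹ * φ₀ (-x₀), x + x₀, inv_ne_zero hk, ?_⟩
  filter_upwards [Metric.ball_mem_nhds x hρ] with y hy
  exact ⟨hsD (Metric.ball_subset_ball (min_le_right r s) hy), heq hy⟩

/-- A function whose gradient is a multiple of `Y / |Y|²`, with `Y` conformal Killing, satisfies the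
bracket condition. -/
lemma carlemanCondition_of_conformalKilling {Y : E n → E n} {c f : ℝ}
    (hgrad : gradient φ =ᶠ[𝓝 x] fun y => c • (‖Y y‖ ^ 2)⁻¹ • Y y) (hY : DifferentiableAt ℝ Y x)
    (h0 : Y x ≠ 0) (hK : ∀ z, inner ℝ (fderiv ℝ Y x z) z = f * ‖z‖ ^ 2) {ξ : E n}
    (hξ : ‖ξ‖ = ‖gradient φ x‖) (hgξ : inner ℝ (gradient φ x) ξ = 0) :
    inner ℝ (fderiv ℝ (gradient φ) x ξ) ξ +
      inner ℝ (fderiv ℝ (gradient φ) x (gradient φ x)) (gradient φ x) = 0 := by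
  have hne : ‖Y x‖ ≠ 0 := norm_ne_zero_iff.2 h0
  have hg := hgrad.self_of_nhds
  have hH (z : E n) : fderiv ℝ (gradient φ) x z = c • ((‖Y x‖ ^ 2)⁻¹ • fderiv ℝ Y x z -
      (2 * inner ℝ (fderiv ℝ Y x z) (Y x) / (‖Y x‖ ^ 2) ^ 2) • Y x) := by
    rw [hgrad.fderiv_eq, fderiv_fun_const_smul (differentiableAt_invert hY h0), smul_apply, fderiv_invert hY h0]
  have hcξ : c * inner ℝ (Y x) ξ = 0 := by
    rw [hg, real_inner_smul_left, real_inner_smul_left] at hgξ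
    field_simp at hgξ
    simpa using hgξ
  -- With this length the two quadratic terms become `±c³ f / |Y|⁴` and cancel; orthogonality
  -- removes the rest.
  have hξ2 : ‖ξ‖ ^ 2 = c ^ 2 / ‖Y x‖ ^ 2 := by
    rw [hξ, hg, norm_smul, norm_smul, norm_inv, norm_pow, norm_norm, Real.norm_eq_abs, mul_pow, sq_abs]
    field_simp
  rw [hH, hH, hg]
  simp only [map_smul, inner_sub_left, real_inner_smul_left, real_inner_smul_right, hK,
    real_inner_self_eq_norm_sq, hξ2]
  field_simp
  linear_combination (-2 * inner ℝ (fderiv ℝ Y x ξ) (Y x)) * hcξ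

lemma isLimitingCarlemanWeight_of_model {Ω : Set (E n)} (h : ∀ x ∈ Ω, IsLocallyModelAt φ x) :
    IsLimitingCarlemanWeight Ω φ := by
  have key : ∀ x ∈ Ω, ContDiffAt ℝ ∞ φ x ∧ fderiv ℝ φ x ≠ 0 ∧
      ∀ ξ : E n, ‖ξ‖ = ‖gradient φ x‖ → inner ℝ (gradient φ x) ξ = 0 →
        inner ℝ (fderiv ℝ (gradient φ) x ξ) ξ +
          inner ℝ (fderiv ℝ (gradient φ) x (gradient φ x)) (gradient φ x) = 0 := by
    intro x hx
    obtain ⟨D, φ₀, hmodel, k, b, x₀, hk, hev⟩ := h x hx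
    obtain ⟨a, c, B, β, hM⟩ := hmodel.exists_hasModelField
    have hφ : φ =ᶠ[𝓝 x] fun y => k * φ₀ (y - x₀) + b := hev.mono fun y hy => hy.2
    have hsm : ContDiffAt ℝ ∞ φ x := by
      refine ContDiffAt.congr_of_eventuallyEq ?_ hφ
      have h1 : ContDiffAt ℝ ∞ (fun y => φ₀ (y - x₀)) x :=
        (hM.smooth _ hev.self_of_nhds.1).comp x (contDiffAt_id.sub contDiffAt_const)
      exact (contDiffAt_const.mul h1).add contDiffAt_const
    have hgrad : gradient φ =ᶠ[𝓝 x] fun y =>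
        k • (‖confField a c B β (y - x₀)‖ ^ 2)⁻¹ • confField a c B β (y - x₀) := by
      filter_upwards [hφ.eventuallyEq_nhds, hev] with y hy hyD
      have h1 : HasFDerivAt φ₀ (fderiv ℝ φ₀ (y - x₀)) (y - x₀) :=
        ((hM.smooth _ hyD.1).differentiableAt (by simp)).hasFDerivAt
      have h2 : HasFDerivAt (fun y => k * φ₀ (y - x₀) + b) (k • fderiv ℝ φ₀ (y - x₀)) y :=
        ((h1.comp y ((hasFDerivAt_id y).sub_const x₀)).const_mul k).add_const b
      refine ext_inner_right ℝ fun z => ?_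
      have h3 := norm_ne_zero_iff.2 (hM.ne_zero _ hyD.1)
      rw [inner_gradient_left, hy.fderiv_eq, h2.fderiv, real_inner_smul_left, real_inner_smul_left,
        ← hM.gradient _ hyD.1 z, smul_apply, smul_eq_mul]
      field_simp
    have h0 := hM.ne_zero _ hev.self_of_nhds.1
    have hY : DifferentiableAt ℝ (fun y => confField a c B β (y - x₀)) x :=
      (((contDiff_confField a c B β (m := 1)).differentiable (by norm_num)) _).comp x
        (differentiableAt_id.sub_const x₀)
    refine ⟨hsm, fun h => ?_, fun ξ => carlemanCondition_of_conformalKilling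
      (f := c + inner ℝ β (x - x₀)) hgrad hY h0 fun z => ?_⟩
    · have h1 := hgrad.self_of_nhds
      rw [gradient, h, map_zero] at h1
      exact smul_ne_zero hk (smul_ne_zero (inv_ne_zero (pow_ne_zero 2 (norm_ne_zero_iff.2 h0))) h0) h1.symm
    · rw [fderiv_comp_sub]
      exact isConformalKilling_confField a c hM.skew β _ (mem_univ _) z
  exact ⟨fun x hx => (key x hx).1.contDiffWithinAt, fun x hx => (key x hx).2.1,
    fun x hx => (carlemanCondition_iff (key x hx).1).2 (key x hx).2.2⟩

end Equivalence

end LimitingCarleman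

theorem theorem2 (n : ℕ) (hn : 3 ≤ n) (Ω : Set (LimitingCarleman.E n)) (hΩ : IsOpen Ω)
    (φ : LimitingCarleman.E n → ℝ) :
    LimitingCarleman.IsLimitingCarlemanWeight Ω φ ↔
      ∀ x ∈ Ω, LimitingCarleman.IsLocallyModelAt φ x :=
  ⟨fun h _ hx => h.isLocallyModelAt hn hΩ hx, LimitingCarleman.isLimitingCarlemanWeight_of_model⟩
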